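/- For a directed graph $G$ with node set $\{0,\dots,n-1\}$ and $m$ edges carrying nonnegative integer weights (weight $1$ for every edge in the unweighted case), let $d(x\to v)\in\{0,1,2,\dots\}\cup\{\infty\}$ be the least total weight of a directed walk from $x$ to $v$ ($\infty$ if there is none), and let the Source Radius be $$R(G)=\min_{x}\max_{v} d(x\to v)\in\{0,1,2,\dots\}\cup\{\infty\}.$$ **Theorem.** For every $c\in\mathbb N$ there is a Monte Carlo algorithm, that is, a fixed program for the randomized word RAM, and there are constants $\kappa\ge 1$ and $C$ such that the following holds. Let $G$ be a directed graph with $n\ge 2$ nodes and $m\ge 1$ edges, given as a list of weighted edges, with integer weights in $[0,M]$, and let the machine have words of $w\ge\kappa\log_2(n+m+M)$ bits. Then the algorithm halts, for every outcome of its random choices, after at most $C\,m\sqrt n\,\log^2 n$ steps, and with probability at least $1-n^{-c}$ it outputs a value $R^*\in\{0,1,2,\dots\}\cup\{\infty\}$ with $$R(G)\le R^*\le 2R(G).$$ Here the randomized word RAM computes with $w$-bit words stored in variables and in randomly accessible arrays, with unit cost for arithmetic and comparison of two words, array access, assignment, test, and the drawing of an independent uniformly random word. -/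

import Mathlib

open scoped ENNReal

/-! ## Weighted directed graphs and the source radius -/

/-- A directed graph on the node set `Fin n` with `m` edges that carry nonnegative integer
weights, given by its list of edges.  An unweighted graph has all weights equal to `1`. -/
structure WDigraph (n m : ℕ) where
  src : Fin m → Fin n
  dst : Fin m → Fin n
  wt : Fin m → ℕ

namespace WDigraph

variable {n m : ℕ}

/-- `G.Walk u v L`: there is a directed walk from `u` to `v` of total weight `L`. -/
inductive Walk (G : WDigraph n m) : Fin n → Fin n → ℕ → Prop
  | nil (v : Fin n) : Walk G v v 0
  | cons (e : Fin m) {v : Fin n} {L : ℕ} (h : Walk G (G.dst e) v L) :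
      Walk G (G.src e) v (G.wt e + L)

/-- The distance `d(u → v)`: the least weight of a directed walk from `u` to `v`, and `⊤` if
`v` cannot be reached from `u`. -/
noncomputable def dist (G : WDigraph n m) (u v : Fin n) : ℕ∞ :=
  ⨅ (L : ℕ) (_ : G.Walk u v L), (L : ℕ∞)

/-- The source radius: the minimum over nodes `x` of the maximum over nodes `v` of `d(x → v)`. -/
noncomputable def sourceRadius (G : WDigraph n m) : ℕ∞ :=
  ⨅ x : Fin n, ⨆ v : Fin n, G.dist x v

end WDigraph

/-! ## Randomized word RAM

A machine with words of `w` bits (natural numbers below `2 ^ w`), word-sized variables, and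
randomly accessible arrays indexed by words.  A program mentions only finitely many variables and
arrays.  Every operation on words, every array access, every assignment, every test and every
draw of a random word costs one step. -/

namespace WordRAM

/-- Operations on two words. `sub` is truncated at `0`; `lt` and `eq` return `1` for true and `0`
for false. -/
inductive BinOp
  | add | sub | mul | div | mod | lt | eq

/-- The result of an operation on `w`-bit words, again a `w`-bit word. -/
def BinOp.apply (w : ℕ) : BinOp → ℕ → ℕ → ℕ
  | .add, a, b => (a + b) % 2 ^ w
  | .sub, a, b => (a - b) % 2 ^ w
  | .mul, a, b => (a * b) % 2 ^ w
  | .div, a, b => (a / b) % 2 ^ w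
  | .mod, a, b => (a % b) % 2 ^ w
  | .lt, a, b => (if a < b then 1 else 0) % 2 ^ w
  | .eq, a, b => (if a = b then 1 else 0) % 2 ^ w

/-- Expressions: constants, variables, array reads `a[e]`, and operations. -/
inductive Expr
  | lit (k : ℕ)
  | var (x : ℕ)
  | get (a : ℕ) (e : Expr)
  | op (o : BinOp) (e₁ e₂ : Expr)

/-- Programs. `store a i e` is `a[i] := e`; `rand x` writes a fresh random word to `x`; a
condition holds when its value is not `0`. -/
inductive Cmd
  | skip
  | assign (x : ℕ) (e : Expr)
  | store (a : ℕ) (i e : Expr)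
  | rand (x : ℕ)
  | seq (p q : Cmd)
  | branch (e : Expr) (p q : Cmd)
  | loop (e : Expr) (p : Cmd)

/-- A state: the variables, the arrays, and the number of random words used so far. -/
structure State where
  var : ℕ → ℕ
  arr : ℕ → ℕ → ℕ
  used : ℕ

/-- The value of an expression on `w`-bit words. -/
def Expr.eval (w : ℕ) (s : State) : Expr → ℕ
  | .lit k => k % 2 ^ w
  | .var x => s.var x
  | .get a e => s.arr a (e.eval w s)
  | .op o e₁ e₂ => o.apply w (e₁.eval w s) (e₂.eval w s)

/-- The number of steps needed to evaluate an expression. -/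
def Expr.cost : Expr → ℕ
  | .lit _ => 1
  | .var _ => 1
  | .get _ e => e.cost + 1
  | .op _ e₁ e₂ => e₁.cost + e₂.cost + 1

/-- Assign `v` to the variable `x`. -/
def State.setVar (s : State) (x v : ℕ) : State :=
  { s with var := Function.update s.var x v }

/-- Write `v` to the cell `i` of the array `a`. -/
def State.setArr (s : State) (a i v : ℕ) : State :=
  { s with arr := Function.update s.arr a (Function.update (s.arr a) i v) }

/-- `Exec w ω p s t s'`: on `w`-bit words, with `ω` as the sequence of random words, the program
`p` started in the state `s` halts after exactly `t` steps in the state `s'`. -/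
inductive Exec (w : ℕ) (ω : ℕ → Fin (2 ^ w)) : Cmd → State → ℕ → State → Prop
  | skip (s : State) : Exec w ω .skip s 1 s
  | assign (x : ℕ) (e : Expr) (s : State) :
      Exec w ω (.assign x e) s (e.cost + 1) (s.setVar x (e.eval w s))
  | store (a : ℕ) (i e : Expr) (s : State) :
      Exec w ω (.store a i e) s (i.cost + e.cost + 1) (s.setArr a (i.eval w s) (e.eval w s))
  | rand (x : ℕ) (s : State) :
      Exec w ω (.rand x) s 1 { s.setVar x (ω s.used : ℕ) with used := s.used + 1 }
  | seq {p q : Cmd} {s s₁ s₂ : State} {t₁ t₂ : ℕ} :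
      Exec w ω p s t₁ s₁ → Exec w ω q s₁ t₂ s₂ → Exec w ω (.seq p q) s (t₁ + t₂) s₂
  | branch_true {e : Expr} {p q : Cmd} {s s' : State} {t : ℕ} :
      e.eval w s ≠ 0 → Exec w ω p s t s' → Exec w ω (.branch e p q) s (e.cost + 1 + t) s'
  | branch_false {e : Expr} {p q : Cmd} {s s' : State} {t : ℕ} :
      e.eval w s = 0 → Exec w ω q s t s' → Exec w ω (.branch e p q) s (e.cost + 1 + t) s'
  | loop_stop {e : Expr} {p : Cmd} {s : State} :
      e.eval w s = 0 → Exec w ω (.loop e p) s (e.cost + 1) s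
  | loop_step {e : Expr} {p : Cmd} {s s₁ s₂ : State} {t₁ t₂ : ℕ} :
      e.eval w s ≠ 0 → Exec w ω p s t₁ s₁ → Exec w ω (.loop e p) s₁ t₂ s₂ →
        Exec w ω (.loop e p) s (e.cost + 1 + t₁ + t₂) s₂

/-- For a fixed sequence of random words the execution is deterministic: the final state and the
number of steps are unique. -/
theorem Exec.unique {w : ℕ} {ω : ℕ → Fin (2 ^ w)} {p : Cmd} {s s₁ s₂ : State} {t₁ t₂ : ℕ}
    (h₁ : Exec w ω p s t₁ s₁) (h₂ : Exec w ω p s t₂ s₂) : t₁ = t₂ ∧ s₁ = s₂ := by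
  induction h₁ generalizing t₂ s₂ with
  | skip | assign | store | rand => cases h₂; exact ⟨rfl, rfl⟩
  | seq _ _ ih ih' =>
    cases h₂ with
    | seq a b =>
      obtain ⟨rfl, rfl⟩ := ih a
      obtain ⟨rfl, rfl⟩ := ih' b
      exact ⟨rfl, rfl⟩
  | branch_true h _ ih =>
    cases h₂ with
    | branch_true _ a => obtain ⟨rfl, rfl⟩ := ih a; exact ⟨rfl, rfl⟩
    | branch_false h' _ => exact absurd h' h
  | branch_false h _ ih =>
    cases h₂ with
    | branch_true h' _ => exact absurd h h'
    | branch_false _ a => obtain ⟨rfl, rfl⟩ := ih a; exact ⟨rfl, rfl⟩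
  | loop_stop h =>
    cases h₂ with
    | loop_stop _ => exact ⟨rfl, rfl⟩
    | loop_step h' _ _ => exact absurd h h'
  | loop_step h _ _ ih ih' =>
    cases h₂ with
    | loop_stop h' => exact absurd h' h
    | loop_step _ a b =>
      obtain ⟨rfl, rfl⟩ := ih a
      obtain ⟨rfl, rfl⟩ := ih' b
      exact ⟨rfl, rfl⟩

/-- The law of a sequence of independent, uniformly distributed `w`-bit words. -/
noncomputable def randomWords (w : ℕ) : MeasureTheory.Measure (ℕ → Fin (2 ^ w)) :=
  MeasureTheory.Measure.infinitePi fun _ : ℕ =>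
    (PMF.uniformOfFintype (Fin (2 ^ w))).toMeasure

/-- The initial state on the input graph `G`: the numbers of nodes and edges are in the
variables `0` and `1`; tail, head and weight of the edges are in the arrays `0`, `1` and `2`;
everything else is `0`. -/
def input {n m : ℕ} (G : WDigraph n m) : State where
  var := fun x => if x = 0 then n else if x = 1 then m else 0
  arr := fun a i =>
    if h : i < m then
      if a = 0 then (G.src ⟨i, h⟩ : ℕ)
      else if a = 1 then (G.dst ⟨i, h⟩ : ℕ)
      else if a = 2 then G.wt ⟨i, h⟩
      else 0
    else 0
  used := 0

/-- The output in a final state: `⊤` if the variable `1` is not `0`, and otherwise the number in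
the variable `0`. -/
def State.output (s : State) : ℕ∞ :=
  if s.var 1 = 0 then (s.var 0 : ℕ∞) else ⊤

end WordRAM

/-! Let `R` be the radius, `c` a center, `q` the rounded-up square root of `n`, and `S` a random set
of about `√n log n` nodes. Let `x₁` minimize the largest distance to a node of `S`, let `z` maximize
the smallest distance from `S`, and let `Y` consist of `q` nodes with the smallest distances to `z`.
The answer is the least eccentricity among `x₁` and the nodes of `Y`, so it is never below `R`. If
`c ∈ Y`, it equals `R`. Otherwise `Y` lies in the ball `{y : d(y → z) ≤ d(c → z)}`, which thus has
at least `q` nodes and is very likely met by `S`. Then some sample reaches `z` within `R`; by the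
extremal choice of `z`, every node is reached within `R` from some sample. Since `c` reaches all of
`S` within `R`, so does `x₁`, and the triangle inequality bounds the eccentricity of `x₁` by `2R`
(`radius_approx`).

The node `z` depends on `S`. Therefore `S` is required to meet every ball `{y : d(y → v) ≤ d(x →
v)}` with at least `q` nodes (`HitsBalls`). There are at most `n ^ 2` of them, and the union bound
in `randomWords_not_hitsBalls_le` controls the failure.

The cost is that of `O(√n log n)` runs of Dijkstra's algorithm with a tournament tree as priority
queue, each in time `O((n + m) log n)` (`run_shortestPaths`); distances towards a node come from the
reversed graph. The term `n` is absorbed by `m`, because a graph with fewer than `n - 1` edges has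
infinite radius (`sourceRadius_eq_top`). Infinity is encoded by capping distances at `n * W + 1` for
the maximum weight `W`: finite distances are at most `n * W` (`dist_le_mul`).

The program is verified with a weakest-precondition calculus that tracks time. `run_radius` is
deterministic: the time bound holds for every sequence of random words, and the approximation holds
whenever the samples hit the balls. -/

namespace WordRAM

/-! ## Weakest preconditions with running time -/

/-- The program `p` halts from `s`, and its running time and final state satisfy `Q`. -/
def Run (w : ℕ) (ω : ℕ → Fin (2 ^ w)) (p : Cmd) (s : State) (Q : ℕ → State → Prop) : Prop :=
  ∃ t s', Exec w ω p s t s' ∧ Q t s'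

variable {w : ℕ} {ω : ℕ → Fin (2 ^ w)} {s : State} {p q : Cmd} {e i : Expr}
  {Q Q' : ℕ → State → Prop}

theorem Run.mono (h : Run w ω p s Q) (hQ : ∀ t s', Q t s' → Q' t s') : Run w ω p s Q' := by
  obtain ⟨t, s', h, hq⟩ := h
  exact ⟨t, s', h, hQ _ _ hq⟩

-- This rule and its companions are equivalences tagged `simp`, so that `simp` executes
-- straight-line code symbolically.
@[simp] theorem run_skip : Run w ω .skip s Q ↔ Q 1 s :=
  ⟨fun ⟨_, _, h, hq⟩ => by cases h; exact hq, fun h => ⟨_, _, .skip s, h⟩⟩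

@[simp] theorem run_assign {x : ℕ} :
    Run w ω (.assign x e) s Q ↔ Q (e.cost + 1) (s.setVar x (e.eval w s)) :=
  ⟨fun ⟨_, _, h, hq⟩ => by cases h; exact hq, fun h => ⟨_, _, .assign x e s, h⟩⟩

@[simp] theorem run_store {a : ℕ} :
    Run w ω (.store a i e) s Q ↔
      Q (i.cost + e.cost + 1) (s.setArr a (i.eval w s) (e.eval w s)) :=
  ⟨fun ⟨_, _, h, hq⟩ => by cases h; exact hq, fun h => ⟨_, _, .store a i e s, h⟩⟩

@[simp] theorem run_rand {x : ℕ} :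
    Run w ω (.rand x) s Q ↔
      Q 1 { s.setVar x (ω s.used : ℕ) with used := s.used + 1 } :=
  ⟨fun ⟨_, _, h, hq⟩ => by cases h; exact hq, fun h => ⟨_, _, .rand x s, h⟩⟩

@[simp] theorem run_seq :
    Run w ω (.seq p q) s Q ↔
      Run w ω p s (fun t s' => Run w ω q s' (fun t' s'' => Q (t + t') s'')) := by
  constructor
  · rintro ⟨t, s', h, hq⟩
    cases h with
    | seq a b => exact ⟨_, _, a, _, _, b, hq⟩
  · rintro ⟨t, s', h, t', s'', h', hq⟩
    exact ⟨_, _, .seq h h', hq⟩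

@[simp] theorem run_branch :
    Run w ω (.branch e p q) s Q ↔
      (e.eval w s ≠ 0 → Run w ω p s (fun t s' => Q (e.cost + 1 + t) s')) ∧
      (e.eval w s = 0 → Run w ω q s (fun t s' => Q (e.cost + 1 + t) s')) := by
  constructor
  · rintro ⟨t, s', h, hq⟩
    cases h with
    | branch_true h1 h2 => exact ⟨fun _ => ⟨_, _, h2, hq⟩, fun h => absurd h h1⟩
    | branch_false h1 h2 => exact ⟨fun h => absurd h1 h, fun _ => ⟨_, _, h2, hq⟩⟩
  · rintro ⟨h1, h2⟩
    by_cases h : e.eval w s = 0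
    · obtain ⟨_, _, h', hq⟩ := h2 h
      exact ⟨_, _, .branch_false h h', hq⟩
    · obtain ⟨_, _, h', hq⟩ := h1 h
      exact ⟨_, _, .branch_true h h', hq⟩

/-! ## Frames -/

/-- Whether the program may write to the variable. -/
def Cmd.wv : Cmd → ℕ → Bool
  | .skip, _ => false
  | .assign x _, y => y == x
  | .store _ _ _, _ => false
  | .rand x, y => y == x
  | .seq p q, y => p.wv y || q.wv y
  | .branch _ p q, y => p.wv y || q.wv y
  | .loop _ p, y => p.wv y

/-- Whether the program may write to the array. -/
def Cmd.wa : Cmd → ℕ → Bool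
  | .skip, _ => false
  | .assign _ _, _ => false
  | .store a _ _, b => b == a
  | .rand _, _ => false
  | .seq p q, y => p.wa y || q.wa y
  | .branch _ p q, y => p.wa y || q.wa y
  | .loop _ p, y => p.wa y

/-- Whether the program may draw random words. -/
def Cmd.draws : Cmd → Bool
  | .skip => false
  | .assign _ _ => false
  | .store _ _ _ => false
  | .rand _ => true
  | .seq p q => p.draws || q.draws
  | .branch _ p q => p.draws || q.draws
  | .loop _ p => p.draws

/-- The states differ only where the program may write. -/
structure Frame (p : Cmd) (s s' : State) : Prop where
  var : ∀ x, p.wv x = false → s'.var x = s.var x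
  arr : ∀ a, p.wa a = false → s'.arr a = s.arr a
  used : p.draws = false → s'.used = s.used

theorem Frame.refl (p : Cmd) (s : State) : Frame p s s :=
  ⟨fun _ _ => rfl, fun _ _ => rfl, fun _ => rfl⟩

theorem Frame.trans {s₁ s₂ s₃ : State} (h : Frame p s₁ s₂) (h' : Frame p s₂ s₃) :
    Frame p s₁ s₃ :=
  ⟨fun x hx => (h'.var x hx).trans (h.var x hx), fun x hx => (h'.arr x hx).trans (h.arr x hx),
    fun hx => (h'.used hx).trans (h.used hx)⟩

theorem Frame.weaken {s₁ s₂ : State} (h : Frame p s₁ s₂) (hv : ∀ x, q.wv x = false → p.wv x = false)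
    (ha : ∀ x, q.wa x = false → p.wa x = false) (hd : q.draws = false → p.draws = false) :
    Frame q s₁ s₂ :=
  ⟨fun x hx => h.var x (hv x hx), fun x hx => h.arr x (ha x hx), fun hx => h.used (hd hx)⟩

/-- Loop invariants need to mention only what the loop changes; the rest is recovered from here. The
write sets are computable Booleans, so for concrete programs the side conditions close by `rfl`. -/
theorem Exec.frame {t : ℕ} {s' : State} (h : Exec w ω p s t s') : Frame p s s' := by
  induction h with
  | skip => exact .refl _ _
  | assign x e s =>
    refine ⟨fun y hy => ?_, fun _ _ => rfl, fun _ => rfl⟩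
    simp only [Cmd.wv, beq_eq_false_iff_ne] at hy
    simp [State.setVar, hy]
  | store a i e s =>
    refine ⟨fun _ _ => rfl, fun y hy => ?_, fun _ => rfl⟩
    simp only [Cmd.wa, beq_eq_false_iff_ne] at hy
    simp [State.setArr, hy]
  | rand x s =>
    refine ⟨fun y hy => ?_, fun _ _ => rfl, fun h => by simp [Cmd.draws] at h⟩
    simp only [Cmd.wv, beq_eq_false_iff_ne] at hy
    simp [State.setVar, hy]
  | seq _ _ ih ih' =>
    refine Frame.trans (ih.weaken ?_ ?_ ?_) (ih'.weaken ?_ ?_ ?_) <;>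
      simp +contextual [Cmd.wv, Cmd.wa, Cmd.draws]
  | branch_true _ _ ih =>
    refine (ih.weaken ?_ ?_ ?_) <;> simp +contextual [Cmd.wv, Cmd.wa, Cmd.draws]
  | branch_false _ _ ih =>
    refine (ih.weaken ?_ ?_ ?_) <;> simp +contextual [Cmd.wv, Cmd.wa, Cmd.draws]
  | loop_stop => exact .refl _ _
  | loop_step _ _ _ ih ih' =>
    refine Frame.trans (ih.weaken ?_ ?_ ?_) ih' <;> simp [Cmd.wv, Cmd.wa, Cmd.draws]

theorem Run.framed (h : Run w ω p s Q) : Run w ω p s (fun t s' => Q t s' ∧ Frame p s s') := by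
  obtain ⟨t, s', h, hq⟩ := h
  exact ⟨t, s', h, hq, h.frame⟩

/-- Consequence rule that provides the frame of the program. -/
theorem Run.conseq (h : Run w ω p s Q) (hQ : ∀ t s', Q t s' → Frame p s s' → Q' t s') :
    Run w ω p s Q' :=
  h.framed.mono fun t s' hs => hQ t s' hs.1 hs.2

/-! ## Loops -/

/-- Loop rule. The invariant `I T s` may refer to the time `T` spent so far; termination follows
from a bound on this time. -/
theorem Run.loop (I : ℕ → State → Prop) (N : ℕ) (h0 : I 0 s)
    (hN : ∀ T s', I T s' → Frame p s s' → T ≤ N)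
    (hstep : ∀ T s', I T s' → Frame p s s' → e.eval w s' ≠ 0 →
      Run w ω p s' (fun t s'' => I (T + (e.cost + 1 + t)) s''))
    (hend : ∀ T s', I T s' → Frame p s s' → e.eval w s' = 0 → Q (T + (e.cost + 1)) s') :
    Run w ω (.loop e p) s Q := by
  -- Every round costs at least one step, so the unspent budget `N - T` decreases and serves as
  -- induction measure.
  suffices H : ∀ k T s', N - T ≤ k → I T s' → Frame p s s' →
      Run w ω (.loop e p) s' (fun t s'' => Q (T + t) s'') by
    simpa using H (N - 0) 0 s le_rfl h0 (.refl _ _)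
  intro k
  induction k with
  | zero =>
    intro T s' hk hI hF
    by_cases he : e.eval w s' = 0
    · exact ⟨_, _, Exec.loop_stop he, hend T s' hI hF he⟩
    · obtain ⟨t, s'', hx, hI'⟩ := hstep T s' hI hF he
      have := hN _ _ hI' (hF.trans hx.frame)
      omega
  | succ k ih =>
    intro T s' hk hI hF
    by_cases he : e.eval w s' = 0
    · exact ⟨_, _, Exec.loop_stop he, hend T s' hI hF he⟩
    · obtain ⟨t, s'', hx, hI'⟩ := hstep T s' hI hF he
      obtain ⟨t', s₃, hx', hQ⟩ := ih _ s'' (by omega) hI' (hF.trans hx.frame)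
      refine ⟨_, _, .loop_step he hx hx', ?_⟩
      have : T + (e.cost + 1 + t + t') = T + (e.cost + 1 + t) + t' := by omega
      change Q (T + (e.cost + 1 + t + t')) s₃
      rw [this]
      exact hQ

/-! ## Notation for programs and expressions -/

infixr:60 ";;" => Cmd.seq

instance : Add Expr := ⟨.op .add⟩
instance : Sub Expr := ⟨.op .sub⟩
instance : Mul Expr := ⟨.op .mul⟩
instance : Div Expr := ⟨.op .div⟩
instance : Mod Expr := ⟨.op .mod⟩
instance (k : ℕ) : OfNat Expr k := ⟨.lit k⟩

@[simp] theorem Expr.eval_add (a b : Expr) :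
    (a + b).eval w s = (a.eval w s + b.eval w s) % 2 ^ w := rfl
@[simp] theorem Expr.eval_sub (a b : Expr) :
    (a - b).eval w s = (a.eval w s - b.eval w s) % 2 ^ w := rfl
@[simp] theorem Expr.eval_mul (a b : Expr) :
    (a * b).eval w s = (a.eval w s * b.eval w s) % 2 ^ w := rfl
@[simp] theorem Expr.eval_div (a b : Expr) :
    (a / b).eval w s = (a.eval w s / b.eval w s) % 2 ^ w := rfl
@[simp] theorem Expr.eval_mod (a b : Expr) :
    (a % b).eval w s = (a.eval w s % b.eval w s) % 2 ^ w := rfl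
@[simp] theorem Expr.eval_lit (k : ℕ) : (Expr.lit k).eval w s = k % 2 ^ w := rfl
@[simp] theorem Expr.eval_zero : (0 : Expr).eval w s = 0 := Nat.zero_mod _
@[simp] theorem Expr.eval_one : (1 : Expr).eval w s = 1 % 2 ^ w := rfl
@[simp] theorem Expr.eval_two : (2 : Expr).eval w s = 2 % 2 ^ w := rfl
@[simp] theorem Expr.eval_lt (a b : Expr) : (Expr.op .lt a b).eval w s =
    (if a.eval w s < b.eval w s then 1 else 0) % 2 ^ w := rfl
@[simp] theorem Expr.eval_eq (a b : Expr) : (Expr.op .eq a b).eval w s =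
    (if a.eval w s = b.eval w s then 1 else 0) % 2 ^ w := rfl
@[simp] theorem Expr.eval_var (x : ℕ) : (Expr.var x).eval w s = s.var x := rfl
@[simp] theorem Expr.eval_get (a : ℕ) (e : Expr) :
    (Expr.get a e).eval w s = s.arr a (e.eval w s) := rfl

/-- The word size matters: with `w = 0` the truth value `1` would itself be reduced to `0`. -/
theorem Expr.eval_lt_eq_zero (hw : 1 < 2 ^ w) (a b : Expr) :
    (Expr.op .lt a b).eval w s = 0 ↔ b.eval w s ≤ a.eval w s := by
  rw [eval_lt]
  split_ifs with h
  · rw [Nat.mod_eq_of_lt hw]; omega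
  · simp; omega

theorem Expr.eval_eq_eq_zero (hw : 1 < 2 ^ w) (a b : Expr) :
    (Expr.op .eq a b).eval w s = 0 ↔ a.eval w s ≠ b.eval w s := by
  rw [eval_eq]
  split_ifs with h
  · rw [Nat.mod_eq_of_lt hw]; simp [h]
  · simp [h]

@[simp] theorem Expr.cost_add (a b : Expr) : (a + b).cost = a.cost + b.cost + 1 := rfl
@[simp] theorem Expr.cost_sub (a b : Expr) : (a - b).cost = a.cost + b.cost + 1 := rfl
@[simp] theorem Expr.cost_mul (a b : Expr) : (a * b).cost = a.cost + b.cost + 1 := rfl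
@[simp] theorem Expr.cost_div (a b : Expr) : (a / b).cost = a.cost + b.cost + 1 := rfl
@[simp] theorem Expr.cost_mod (a b : Expr) : (a % b).cost = a.cost + b.cost + 1 := rfl
@[simp] theorem Expr.cost_lit (k : ℕ) : (Expr.lit k).cost = 1 := rfl
@[simp] theorem Expr.cost_zero : (0 : Expr).cost = 1 := rfl
@[simp] theorem Expr.cost_one : (1 : Expr).cost = 1 := rfl
@[simp] theorem Expr.cost_two : (2 : Expr).cost = 1 := rfl
@[simp] theorem Expr.cost_op (o : BinOp) (a b : Expr) :
    (Expr.op o a b).cost = a.cost + b.cost + 1 := rfl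
@[simp] theorem Expr.cost_var (x : ℕ) : (Expr.var x).cost = 1 := rfl
@[simp] theorem Expr.cost_get (a : ℕ) (e : Expr) : (Expr.get a e).cost = e.cost + 1 := rfl

@[simp] theorem State.var_setVar (s : State) (x v y : ℕ) :
    (s.setVar x v).var y = if y = x then v else s.var y := by
  simp [setVar, Function.update_apply]
@[simp] theorem State.arr_setVar (s : State) (x v : ℕ) : (s.setVar x v).arr = s.arr := rfl
@[simp] theorem State.used_setVar (s : State) (x v : ℕ) : (s.setVar x v).used = s.used := rfl
@[simp] theorem State.var_setArr (s : State) (a i v : ℕ) : (s.setArr a i v).var = s.var := rfl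
@[simp] theorem State.arr_setArr (s : State) (a i v b : ℕ) :
    (s.setArr a i v).arr b = if b = a then Function.update (s.arr a) i v else s.arr b := by
  simp only [setArr, Function.update_apply]

/-- `for x in 0, …, N - 1: body`. -/
def Cmd.forUpTo (x : ℕ) (N : Expr) (body : Cmd) : Cmd :=
  .seq (.assign x 0) (.loop (.op .lt (.var x) N) (.seq body (.assign x (.var x + 1))))

/-- Rule for counting loops. The invariant `I k T s` refers to the number `k` of completed rounds
and to the time `T` spent so far. -/
theorem Run.forUpTo {x : ℕ} {N : Expr} {body : Cmd} (B : ℕ) (hw : 1 < 2 ^ w) (hB : B < 2 ^ w)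
    (hx : body.wv x = false)
    (I : ℕ → ℕ → State → Prop)
    (hN : ∀ s', Frame (.forUpTo x N body) s s' → N.eval w s' = B)
    (h0 : I 0 2 (s.setVar x 0))
    (hstep : ∀ k T s', k < B → s'.var x = k → Frame (.forUpTo x N body) s s' → I k T s' →
      Run w ω body s' (fun t s'' => I (k + 1) (T + (t + N.cost + 7)) (s''.setVar x (k + 1))))
    (hend : ∀ T s', Frame (.forUpTo x N body) s s' → I B T s' → Q (T + (N.cost + 3)) s') :
    Run w ω (.forUpTo x N body) s Q := by
  -- Induction on the number `d` of rounds left. Each round pays `N.cost + 3` for the test and `4`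
  -- for the increment; the failing last test accounts for the final `N.cost + 3`.
  have key : ∀ d k T s', k + d = B → s'.var x = k → Frame (.forUpTo x N body) s s' → I k T s' →
      Run w ω (.loop (.op .lt (.var x) N) (.seq body (.assign x (.var x + 1)))) s'
        (fun t s'' => Q (T + t) s'') := by
    intro d
    induction d with
    | zero =>
      intro k T s' hk hv hF hI
      obtain rfl : k = B := by omega
      refine ⟨_, _, Exec.loop_stop ((Expr.eval_lt_eq_zero hw _ _).2 ?_), ?_⟩
      · rw [hN _ hF, Expr.eval_var, hv]
      · have := hend T s' hF hI
        simp only [Expr.cost_op, Expr.cost_var]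
        convert this using 1
        omega
    | succ d ih =>
      intro k T s' hk hv hF hI
      obtain ⟨t, s₁, h1, hI1⟩ := hstep k T s' (by omega) hv hF hI
      have hv1 : s₁.var x = k := by rw [h1.frame.var x hx, hv]
      have h2 : Exec w ω (.assign x (.var x + 1)) s₁ 4 (s₁.setVar x (k + 1)) := by
        have h := Exec.assign (w := w) (ω := ω) x (.var x + 1) s₁
        have e1 : (Expr.var x + 1).eval w s₁ = k + 1 := by
          rw [Expr.eval_add, Expr.eval_var, hv1, Expr.eval_one, Nat.mod_eq_of_lt hw,
            Nat.mod_eq_of_lt (by omega)]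
        rw [e1] at h
        exact h
      have hF1 : Frame (.forUpTo x N body) s (s₁.setVar x (k + 1)) :=
        hF.trans ((Exec.seq h1 h2).frame.weaken
          (by simp +contextual [Cmd.forUpTo, Cmd.wv]) (by simp +contextual [Cmd.forUpTo, Cmd.wa])
          (by simp +contextual [Cmd.forUpTo, Cmd.draws]))
      obtain ⟨t', s₂, h3, hQ⟩ := ih (k + 1) _ _ (by omega) (by simp [State.setVar]) hF1 hI1
      refine ⟨_, _, .loop_step ?_ (.seq h1 h2) h3, ?_⟩
      · rw [Ne, Expr.eval_lt_eq_zero hw, hN _ hF, Expr.eval_var, hv]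
        omega
      · simp only [Expr.cost_op, Expr.cost_var]
        convert hQ using 1
        omega
  have h1 : Exec w ω (.assign x 0) s 2 (s.setVar x 0) := by
    have h := Exec.assign (w := w) (ω := ω) x 0 s
    have e0 : (0 : Expr).eval w s = 0 := Expr.eval_zero
    rw [e0] at h
    exact h
  obtain ⟨t, s', h2, hQ⟩ := key B 0 2 (s.setVar x 0) (by omega) (by simp [State.setVar])
    (h1.frame.weaken (by simp +contextual [Cmd.forUpTo, Cmd.wv])
      (by simp +contextual [Cmd.forUpTo, Cmd.wa])
      (by simp +contextual [Cmd.forUpTo, Cmd.draws])) h0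
  exact ⟨_, _, .seq h1 h2, hQ⟩

end WordRAM

namespace WDigraph

variable {n m : ℕ}

/-! ## Walks and distances -/

/-- The graph with all edges reversed. -/
def reverse (G : WDigraph n m) : WDigraph n m := ⟨G.dst, G.src, G.wt⟩

theorem Walk.append {G : WDigraph n m} {u v x : Fin n} {L L' : ℕ} (h : G.Walk u v L)
    (h' : G.Walk v x L') : G.Walk u x (L + L') := by
  induction h with
  | nil v => simpa using h'
  | cons e _ ih => rw [add_assoc]; exact .cons e (ih h')

theorem Walk.snoc {G : WDigraph n m} {u : Fin n} {L : ℕ} (e : Fin m) (h : G.Walk u (G.src e) L) :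
    G.Walk u (G.dst e) (L + G.wt e) :=
  h.append (by simpa using Walk.cons e (Walk.nil (G.dst e)))

theorem Walk.reverse {G : WDigraph n m} {u v : Fin n} {L : ℕ} (h : G.Walk u v L) :
    G.reverse.Walk v u L := by
  induction h with
  | nil v => exact .nil v
  | cons e _ ih => rw [add_comm]; exact Walk.snoc (G := G.reverse) e ih

theorem dist_le_of_walk {G : WDigraph n m} {u v : Fin n} {L : ℕ} (h : G.Walk u v L) :
    G.dist u v ≤ L := iInf₂_le L h

theorem exists_walk {G : WDigraph n m} {u v : Fin n} (h : G.dist u v ≠ ⊤) :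
    ∃ L : ℕ, G.Walk u v L ∧ G.dist u v = L := by
  classical
  have hex : ∃ L, G.Walk u v L := by
    by_contra! hc
    apply h
    simp [dist, hc]
  refine ⟨Nat.find hex, Nat.find_spec hex, le_antisymm (dist_le_of_walk (Nat.find_spec hex)) ?_⟩
  refine le_iInf₂ fun L hL => ?_
  exact_mod_cast Nat.find_min' hex hL

theorem dist_reverse_le (G : WDigraph n m) (u v : Fin n) : G.reverse.dist v u ≤ G.dist u v :=
  le_iInf₂ fun _ hL => dist_le_of_walk hL.reverse

theorem dist_reverse (G : WDigraph n m) (u v : Fin n) : G.reverse.dist v u = G.dist u v :=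
  le_antisymm (G.dist_reverse_le u v) (G.reverse.dist_reverse_le v u)

theorem dist_triangle (G : WDigraph n m) (u v x : Fin n) :
    G.dist u x ≤ G.dist u v + G.dist v x := by
  by_cases h1 : G.dist u v = ⊤
  · simp [h1]
  by_cases h2 : G.dist v x = ⊤
  · simp [h2]
  obtain ⟨L, hL, e1⟩ := exists_walk h1
  obtain ⟨L', hL', e2⟩ := exists_walk h2
  rw [e1, e2]
  exact_mod_cast dist_le_of_walk (hL.append hL')

/-- A potential that starts at most `0` and grows along every edge by at most the weight of the
edge is a lower bound for the weight of every walk. -/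
theorem Walk.potential_le {G : WDigraph n m} {δ : Fin n → ℕ}
    (hδ : ∀ e, δ (G.dst e) ≤ δ (G.src e) + G.wt e) {u v : Fin n} {L : ℕ} (h : G.Walk u v L) :
    δ v ≤ δ u + L := by
  induction h with
  | nil v => simp
  | cons e _ ih => have := hδ e; omega

/-- Finite distances are at most `n` times the maximum weight. -/
theorem dist_le_mul {G : WDigraph n m} {W : ℕ} (hW : ∀ e, G.wt e ≤ W) {u v : Fin n}
    (h : G.dist u v ≠ ⊤) : G.dist u v ≤ (n * W : ℕ) := by
  classical
  -- Nodes within `k * W` of `u`. The sets grow strictly until they are closed under edges, which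
  -- must happen by `k = n`; this replaces the extraction of simple paths.
  set U : ℕ → Finset (Fin n) := fun k => Finset.univ.filter fun x => ∃ L, L ≤ k * W ∧ G.Walk u x L
    with hU
  have hmono : ∀ k, U k ⊆ U (k + 1) := by
    intro k x hx
    simp only [hU, Finset.mem_filter, Finset.mem_univ, true_and] at hx ⊢
    obtain ⟨L, h1, h2⟩ := hx
    exact ⟨L, h1.trans (Nat.mul_le_mul_right _ (by omega)), h2⟩
  have hclosed : ∀ k, U (k + 1) = U k → U (k + 2) = U (k + 1) := by
    intro k hk
    refine Finset.Subset.antisymm ?_ (hmono _)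
    have hcl : ∀ e, G.src e ∈ U k → G.dst e ∈ U k := by
      intro e he
      rw [← hk]
      simp only [hU, Finset.mem_filter, Finset.mem_univ, true_and] at he ⊢
      obtain ⟨L, h1, h2⟩ := he
      exact ⟨_, by have := hW e; nlinarith, h2.snoc e⟩
    have hwalk : ∀ {a b : Fin n} {L : ℕ}, G.Walk a b L → a ∈ U k → b ∈ U k := by
      intro a b L hab
      induction hab with
      | nil _ => exact id
      | cons e _ ih => exact fun h => ih (hcl e h)
    intro x hx
    rw [hk]
    simp only [hU, Finset.mem_filter, Finset.mem_univ, true_and] at hx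
    obtain ⟨L, -, h2⟩ := hx
    exact hwalk h2 (by
      simp only [hU, Finset.mem_filter, Finset.mem_univ, true_and]
      exact ⟨0, by simp, .nil u⟩)
  have hgrow : ∀ k, k + 1 ≤ (U k).card ∨ U (k + 1) = U k := by
    intro k
    induction k with
    | zero =>
      left
      refine Finset.card_pos.2 ⟨u, ?_⟩
      simp only [hU, Finset.mem_filter, Finset.mem_univ, true_and]
      exact ⟨0, by simp, .nil u⟩
    | succ k ih =>
      by_cases hk : U (k + 1) = U k
      · exact .inr (hclosed k hk)
      · left
        rcases ih with ih | ih
        · have := Finset.card_lt_card ((hmono k).ssubset_of_ne (Ne.symm hk))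
          omega
        · exact absurd ih hk
  have hn : U (n + 1) = U n := by
    rcases hgrow n with h1 | h1
    · have := Finset.card_le_univ (U n)
      rw [Fintype.card_fin] at this
      omega
    · exact h1
  have hall : ∀ k, U (n + k) = U n := by
    have h2 : ∀ k, U (n + k + 1) = U (n + k) := by
      intro k
      induction k with
      | zero => exact hn
      | succ k ih => exact hclosed _ ih
    intro k
    induction k with
    | zero => rfl
    | succ k ih => rw [← ih]; exact h2 k
  obtain ⟨L, hL, e⟩ := exists_walk h
  -- weights may vanish altogether
  rcases Nat.eq_zero_or_pos W with rfl | hWp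
  · have hz : ∀ {a b : Fin n} {L : ℕ}, G.Walk a b L → L = 0 := by
      intro a b L hab
      induction hab with
      | nil _ => rfl
      | cons e _ ih => have := hW e; omega
    rw [e, hz hL]; simp
  -- Since `W ≥ 1`, a walk of weight `L` stays within `(n + L) * W`, an index where the sets are
  -- already stable.
  · have hv : v ∈ U (n + L) := by
      simp only [hU, Finset.mem_filter, Finset.mem_univ, true_and]
      exact ⟨L, by nlinarith, hL⟩
    rw [hall] at hv
    simp only [hU, Finset.mem_filter, Finset.mem_univ, true_and] at hv
    obtain ⟨L', h1, h2⟩ := hv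
    exact (dist_le_of_walk h2).trans (by exact_mod_cast h1)

/-! ### Capped distances and eccentricities -/

/-- The distance, capped at `B`. -/
noncomputable def capDist (G : WDigraph n m) (B : ℕ) (u v : Fin n) : ℕ :=
  (min (G.dist u v) (B : ℕ∞)).toNat

theorem coe_capDist (G : WDigraph n m) (B : ℕ) (u v : Fin n) :
    (G.capDist B u v : ℕ∞) = min (G.dist u v) B :=
  ENat.natCast_toNat (ne_top_of_le_ne_top (ENat.natCast_ne_top B) (min_le_right _ _))

theorem capDist_le (G : WDigraph n m) (B : ℕ) (u v : Fin n) : G.capDist B u v ≤ B := by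
  have := G.coe_capDist B u v
  have h2 : (G.capDist B u v : ℕ∞) ≤ B := by rw [this]; exact min_le_right _ _
  exact_mod_cast h2

theorem capDist_reverse (G : WDigraph n m) (B : ℕ) (u v : Fin n) :
    G.reverse.capDist B v u = G.capDist B u v := by
  rw [capDist, capDist, dist_reverse]

theorem dist_eq_of_capDist_lt {G : WDigraph n m} {B : ℕ} {u v : Fin n}
    (h : G.capDist B u v < B) : G.dist u v = G.capDist B u v := by
  have h1 := G.coe_capDist B u v
  have h2 : (G.capDist B u v : ℕ∞) < B := by exact_mod_cast h
  rw [h1] at h2 ⊢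
  rw [min_lt_iff] at h2
  rcases h2 with h2 | h2
  · exact (min_eq_left h2.le).symm
  · exact absurd h2 (lt_irrefl _)

theorem capDist_le_of_dist_le {G : WDigraph n m} {B : ℕ} {u v : Fin n} {r : ℕ}
    (h : G.dist u v ≤ r) : G.capDist B u v ≤ r := by
  have h1 : (G.capDist B u v : ℕ∞) ≤ r := by
    rw [G.coe_capDist]; exact (min_le_left _ _).trans h
  exact_mod_cast h1

/-- Characterization of capped distances by the relaxation of all edges. -/
theorem capDist_eq {G : WDigraph n m} {B : ℕ} {s : Fin n} {δ : Fin n → ℕ} (h0 : δ s = 0)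
    (hB : ∀ v, δ v ≤ B) (hwalk : ∀ v, δ v = B ∨ G.Walk s v (δ v))
    (hrel : ∀ e, δ (G.dst e) ≤ δ (G.src e) + G.wt e) (v : Fin n) : δ v = G.capDist B s v := by
  have h : (δ v : ℕ∞) = min (G.dist s v) B := by
    apply le_antisymm
    · refine le_min (le_iInf₂ fun L hL => ?_) (by exact_mod_cast hB v)
      have := hL.potential_le hrel
      rw [h0, zero_add] at this
      exact_mod_cast this
    · rcases hwalk v with h | h
      · rw [h]; exact min_le_right _ _
      · exact (min_le_left _ _).trans (dist_le_of_walk h)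
  rw [← coe_capDist] at h
  exact_mod_cast h

/-- The largest capped distance from a node. -/
noncomputable def capEcc (G : WDigraph n m) (B : ℕ) (x : Fin n) : ℕ :=
  Finset.univ.sup fun v => G.capDist B x v

/-- Below the cap no distance is truncated, so the capped eccentricity is the true one. -/
theorem sourceRadius_le_of_capEcc_lt {G : WDigraph n m} {B : ℕ} {x : Fin n}
    (h : G.capEcc B x < B) : G.sourceRadius ≤ G.capEcc B x := by
  refine (iInf_le _ x).trans (iSup_le fun v => ?_)
  have h1 : G.capDist B x v ≤ G.capEcc B x :=
    Finset.le_sup (f := fun v => G.capDist B x v) (Finset.mem_univ v)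
  rw [dist_eq_of_capDist_lt (h1.trans_lt h)]
  exact_mod_cast h1

theorem capEcc_le {G : WDigraph n m} {B : ℕ} {x : Fin n} {r : ℕ}
    (h : ∀ v, G.dist x v ≤ r) : G.capEcc B x ≤ r :=
  Finset.sup_le fun v _ => capDist_le_of_dist_le (h v)

theorem exists_center (G : WDigraph n m) (hn : 0 < n) :
    ∃ x, ∀ v, G.dist x v ≤ G.sourceRadius := by
  have : Nonempty (Fin n) := ⟨⟨0, hn⟩⟩
  obtain ⟨x, hx⟩ := ciInf_mem (fun x : Fin n => ⨆ v, G.dist x v)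
  refine ⟨x, fun v => ?_⟩
  rw [sourceRadius, ← hx]
  exact le_iSup (fun v => G.dist x v) v

/-- A graph with fewer than `n - 1` edges has no source. -/
theorem sourceRadius_eq_top (G : WDigraph n m) (hn : 0 < n) (h : m + 1 < n) :
    G.sourceRadius = ⊤ := by
  by_contra hne
  obtain ⟨x, hx⟩ := G.exists_center hn
  have hex : ∀ v : Fin n, v ≠ x → ∃ e, G.dst e = v := by
    intro v hv
    obtain ⟨L, hL, -⟩ := exists_walk (ne_top_of_le_ne_top hne (hx v))
    -- The last edge of the walk is read off as the first edge of the reversed walk; `v` is its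
    -- head.
    cases hL.reverse with
    | nil => exact absurd rfl hv
    | cons e _ => exact ⟨e, rfl⟩
  have h1 : Finset.univ ⊆ insert x (Finset.univ.image G.dst) := by
    intro v _
    by_cases hv : v = x
    · simp [hv]
    · obtain ⟨e, rfl⟩ := hex v hv
      simp
  have h2 := (Finset.card_le_card h1).trans (Finset.card_insert_le _ _)
  have h3 := Finset.card_image_le (s := (Finset.univ : Finset (Fin m))) (f := G.dst)
  simp only [Finset.card_univ, Fintype.card_fin] at h2 h3
  omega

/-! ### The approximation argument -/

/-- The combinatorial heart of the approximation: `S` are the sampled nodes, `x₁` is a node that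
is close to all of `S`, `z` is a node far from `S`, and `Y` are the nodes closest to `z`. -/
theorem radius_approx {G : WDigraph n m} {W B q : ℕ} (hn : 0 < n) (hW : ∀ e, G.wt e ≤ W)
    (hB : n * W < B) {S : Finset (Fin n)} {x₁ z : Fin n} {Y : Finset (Fin n)} {best : ℕ}
    (hx₁ : ∀ x, (S.sup fun s => G.capDist B x₁ s) ≤ S.sup fun s => G.capDist B x s)
    (hz : ∀ v, (S.sup fun s => B - G.capDist B s z) ≤ S.sup fun s => B - G.capDist B s v)
    (hY : ∀ y ∈ Y, ∀ x ∉ Y, G.capDist B y z ≤ G.capDist B x z) (hq : q ≤ Y.card)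
    (hS : ∀ x v, q ≤ (Finset.univ.filter fun y => G.capDist B y v ≤ G.capDist B x v).card →
      ∃ s ∈ S, G.capDist B s v ≤ G.capDist B x v)
    (hb : best = B ∨ ∃ x, best = G.capEcc B x) (hbB : best ≤ B) (hb₁ : best ≤ G.capEcc B x₁)
    (hbY : ∀ y ∈ Y, best ≤ G.capEcc B y) :
    G.sourceRadius ≤ (if best = B then ⊤ else (best : ℕ∞)) ∧
      (if best = B then ⊤ else (best : ℕ∞)) ≤ 2 * G.sourceRadius := by
  constructor
  · split_ifs with h
    · exact le_top
    · rcases hb with hb | ⟨x, hx⟩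
      · exact absurd hb h
      · rw [hx] at hbB h ⊢
        exact sourceRadius_le_of_capEcc_lt (lt_of_le_of_ne hbB h)
  · by_cases hR : G.sourceRadius = ⊤
    · rw [hR]
      simp
    obtain ⟨c, hc⟩ := G.exists_center hn
    obtain ⟨R, hR'⟩ := ENat.ne_top_iff_exists.1 hR
    rw [← hR'] at hc ⊢
    -- Finite distances are at most `n * W < B`, so a node that reaches everything never touches the
    -- cap.
    have hfin : ∀ {x : Fin n} {r : ℕ}, (∀ v, G.dist x v ≤ r) → G.capEcc B x < B := by
      intro x r h
      refine (capEcc_le (r := n * W) fun v => ?_).trans_lt hB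
      exact dist_le_mul hW (ne_top_of_le_ne_top (ENat.natCast_ne_top r) (h v))
    have hcc : ∀ v, G.capDist B c v ≤ R := fun v => capDist_le_of_dist_le (hc v)
    have hccB : ∀ v, G.capDist B c v < B := fun v =>
      (Finset.le_sup (f := fun v => G.capDist B c v) (Finset.mem_univ v)).trans_lt (hfin hc)
    suffices H : best ≤ 2 * R ∧ best < B by
      rw [if_neg H.2.ne]
      exact_mod_cast H.1
    by_cases hcY : c ∈ Y
    · have h1 := hbY c hcY
      have h2 := hfin hc
      have h3 := capEcc_le (B := B) hc
      omega
    -- As `c` was not selected, all of `Y` is at least as close to `z` as `c`: the ball through `c`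
    -- is large and contains a sample `s₀`.
    · have hsub : Y ⊆ Finset.univ.filter fun y => G.capDist B y z ≤ G.capDist B c z := by
        intro y hy
        simpa using hY y hy c hcY
      obtain ⟨s₀, hs₀, hle₀⟩ := hS c z (hq.trans (Finset.card_le_card hsub))
      have hcov : ∀ v, ∃ s ∈ S, G.capDist B s v ≤ G.capDist B c z := by
        intro v
        -- Closeness is measured by `B - d`. The node `z` is the least covered one, so the closeness
        -- that `s₀` achieves at `z` is achieved by some sample at every `v`.
        have h1 : B - G.capDist B c z ≤ S.sup fun s => B - G.capDist B s v :=
          le_trans (le_trans (Nat.sub_le_sub_left hle₀ B)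
            (Finset.le_sup (f := fun s => B - G.capDist B s z) hs₀)) (hz v)
        have h2 := hccB z
        -- The supremum is attained at a sample because the bound is positive, `d(c → z)` being
        -- below the cap; this also excludes an empty `S`.
        obtain ⟨s, hs, hs'⟩ := (Finset.le_sup_iff (by rw [Nat.bot_eq_zero]; omega)).1 h1
        exact ⟨s, hs, by omega⟩
      have hx₁S : ∀ s ∈ S, G.dist x₁ s ≤ R := by
        intro s hs
        have h1 : G.capDist B x₁ s ≤ S.sup fun s => G.capDist B c s :=
          (Finset.le_sup (f := fun s => G.capDist B x₁ s) hs).trans (hx₁ c)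
        have h2 : (S.sup fun s => G.capDist B c s) < B :=
          (Finset.sup_lt_iff (by rw [Nat.bot_eq_zero]; exact (Nat.zero_le _).trans_lt hB)).2
            fun s _ => hccB s
        have h3 : (S.sup fun s => G.capDist B c s) ≤ R := Finset.sup_le fun s _ => hcc s
        rw [dist_eq_of_capDist_lt (h1.trans_lt h2)]
        exact_mod_cast h1.trans h3
      have hd : ∀ v, G.dist x₁ v ≤ (2 * R : ℕ) := by
        intro v
        obtain ⟨s, hs, hs'⟩ := hcov v
        have h1 : G.dist s v ≤ R := by
          rw [dist_eq_of_capDist_lt (hs'.trans_lt (hccB z))]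
          exact_mod_cast hs'.trans (hcc z)
        calc G.dist x₁ v ≤ G.dist x₁ s + G.dist s v := G.dist_triangle _ _ _
          _ ≤ R + R := add_le_add (hx₁S s hs) h1
          _ = (2 * R : ℕ) := by push_cast; ring
      have h1 := hfin hd
      have h2 := capEcc_le (B := B) hd
      omega

/-! ## Linked lists of edges -/

/-- One more than the last edge below `j` that leaves the node `u`, or `0` if there is none. -/
def lastEdge (G : WDigraph n m) (u : ℕ) : ℕ → ℕ
  | 0 => 0
  | j + 1 => if h : j < m then (if (G.src ⟨j, h⟩ : ℕ) = u then j + 1 else G.lastEdge u j)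
      else G.lastEdge u j

/-- The number of edges below `j` that leave the node `u`. -/
def outCount (G : WDigraph n m) (u j : ℕ) : ℕ :=
  (Finset.univ.filter fun e : Fin m => (e : ℕ) < j ∧ (G.src e : ℕ) = u).card

theorem lastEdge_le (G : WDigraph n m) (u j : ℕ) : G.lastEdge u j ≤ j := by
  induction j with
  | zero => rfl
  | succ j ih =>
    rw [lastEdge]
    split_ifs <;> omega

theorem src_of_lastEdge (G : WDigraph n m) {u j k : ℕ} (h : G.lastEdge u j = k + 1) :
    ∃ hk : k < m, (G.src ⟨k, hk⟩ : ℕ) = u := by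
  induction j with
  | zero => simp [lastEdge] at h
  | succ j ih =>
    rw [lastEdge] at h
    split_ifs at h with h1 h2
    · obtain rfl : j = k := by omega
      exact ⟨h1, h2⟩
    · exact ih h
    · exact ih h

theorem lt_lastEdge (G : WDigraph n m) {u j : ℕ} {e : Fin m} (he : (e : ℕ) < j)
    (hs : (G.src e : ℕ) = u) : (e : ℕ) < G.lastEdge u j := by
  induction j with
  | zero => omega
  | succ j ih =>
    rw [lastEdge]
    rcases Nat.lt_succ_iff_lt_or_eq.1 he with h | h
    · have := ih h
      have h2 := G.lastEdge_le u j
      split_ifs <;> omega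
    · subst h
      simp [hs]

theorem outCount_succ (G : WDigraph n m) {u k : ℕ} (hk : k < m)
    (hs : (G.src ⟨k, hk⟩ : ℕ) = u) : G.outCount u (k + 1) = G.outCount u k + 1 := by
  rw [outCount, outCount, ← Finset.card_insert_of_notMem (a := (⟨k, hk⟩ : Fin m)) (by simp)]
  congr 1
  ext e
  simp only [Finset.mem_filter, Finset.mem_univ, true_and, Finset.mem_insert, Fin.ext_iff]
  constructor
  · rintro ⟨h1, h2⟩
    by_cases h : (e : ℕ) = k
    · exact .inl h
    · exact .inr ⟨by omega, h2⟩
  · rintro (h | ⟨h1, h2⟩)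
    · exact ⟨by omega, by rw [← hs]; congr 2; exact Fin.ext h⟩
    · exact ⟨by omega, h2⟩

/-- Between `lastEdge u j` and `j` there is no edge out of `u`. Thus following the linked list
lowers the count by one per edge, which bounds the rounds of the relaxation loop. -/
theorem outCount_lastEdge (G : WDigraph n m) (u j : ℕ) :
    G.outCount u (G.lastEdge u j) = G.outCount u j := by
  rw [outCount, outCount]
  congr 1
  ext e
  simp only [Finset.mem_filter, Finset.mem_univ, true_and, and_congr_left_iff]
  intro hs
  exact ⟨fun h => h.trans_le (G.lastEdge_le u j), fun h => G.lt_lastEdge h hs⟩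

/-- The fibers of `src` partition the edges. Hence all relaxation loops of one shortest path run
together take `m` rounds. -/
theorem sum_outCount (G : WDigraph n m) : ∑ u : Fin n, G.outCount u m = m := by
  have h := Finset.card_eq_sum_card_fiberwise (f := G.src) (s := Finset.univ) (t := Finset.univ)
    (fun _ _ => by simp)
  rw [Finset.card_univ, Fintype.card_fin] at h
  conv_rhs => rw [h]
  refine Finset.sum_congr rfl fun u _ => ?_
  rw [outCount]
  congr 1
  ext e
  simp [Fin.ext_iff]

end WDigraph

namespace WordRAM

variable {w : ℕ} {ω : ℕ → Fin (2 ^ w)}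

/-! ## Tournament tree -/

/-- The array `T` is a tournament tree with leaves `n, …, 2 * n - 1`, except possibly at the inner
node `p`. -/
def IsTree (n p : ℕ) (T : ℕ → ℕ) : Prop :=
  ∀ j, 1 ≤ j → j < n → j ≠ p → T j = min (T (2 * j)) (T (2 * j + 1))

/-- Only the parent of the changed entry can be violated. The exception `p = 0` stands for no
exception, as inner nodes start at `1`. -/
theorem IsTree.update_leaf {n i : ℕ} {T : ℕ → ℕ} (h : IsTree n 0 T) (hi : n ≤ i) (x : ℕ) :
    IsTree n (i / 2) (Function.update T i x) := by
  intro j h1 h2 h3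
  rw [Function.update_of_ne (by omega), Function.update_of_ne (by omega),
    Function.update_of_ne (by omega)]
  exact h j h1 h2 (by omega)

theorem IsTree.update_inner {n i x : ℕ} {T : ℕ → ℕ} (h : IsTree n i T) (hi : 1 ≤ i)
    (hx : x = min (T (2 * i)) (T (2 * i + 1))) :
    IsTree n (i / 2) (Function.update T i x) := by
  intro j h1 h2 h3
  by_cases hj : j = i
  · subst hj
    rw [Function.update_self, Function.update_of_ne (by omega), Function.update_of_ne (by omega),
      hx]
  · rw [Function.update_of_ne hj, Function.update_of_ne (by omega),
      Function.update_of_ne (by omega)]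
    exact h j h1 h2 hj

/-- Entries do not increase from a position `j` to its parent `j / 2`. -/
theorem IsTree.root_le {n : ℕ} {T : ℕ → ℕ} (h : IsTree n 0 T) {j : ℕ} (h1 : 1 ≤ j)
    (h2 : j < 2 * n) : T 1 ≤ T j := by
  induction j using Nat.strong_induction_on with
  | _ j ih =>
    rcases Nat.eq_or_lt_of_le h1 with h3 | h3
    · rw [h3]
    · have h4 := ih (j / 2) (by omega) (by omega) (by omega)
      have h5 := h (j / 2) (by omega) (by omega) (by omega)
      have h6 : j = 2 * (j / 2) ∨ j = 2 * (j / 2) + 1 := by omega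
      rcases h6 with h6 | h6 <;> rw [← h6] at h5 <;> omega

/-- Restore the tournament tree in the array `8` above the position in the variable `7`. -/
def sift : Cmd :=
  .loop (.op .lt 1 (.var 7))
    (.assign 7 (.var 7 / 2) ;;
      .branch (.op .lt (.get 8 (2 * .var 7)) (.get 8 (2 * .var 7 + 1)))
        (.store 8 (.var 7) (.get 8 (2 * .var 7)))
        (.store 8 (.var 7) (.get 8 (2 * .var 7 + 1))))

theorem run_sift {n i l : ℕ} {s : State} (hn : 2 * n + 2 < 2 ^ w) (hi : s.var 7 = i)
    (hi2 : i < 2 * n) (hl : i < 2 ^ (l + 1)) (hT : IsTree n (i / 2) (s.arr 8)) :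
    Run w ω sift s (fun t s' => t ≤ 33 * l + 4 ∧ IsTree n 0 (s'.arr 8) ∧
      ∀ j, n ≤ j → s'.arr 8 j = s.arr 8 j) := by
  have hw : 1 < 2 ^ w := by omega
  -- The only possible violation sits at `i / 2` and moves up one level per round, at 33 steps each;
  -- `k` bounds the levels left. At the end `i ≤ 1`, so `i / 2 = 0` is not an inner node.
  refine Run.loop (fun T s' => ∃ i k, s'.var 7 = i ∧ i < 2 * n ∧ i < 2 ^ (k + 1) ∧
    T + 33 * k ≤ 33 * l ∧ IsTree n (i / 2) (s'.arr 8) ∧ ∀ j, n ≤ j → s'.arr 8 j = s.arr 8 j)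
    (33 * l) ⟨i, l, hi, hi2, hl, by omega, hT, fun _ _ => rfl⟩ ?_ ?_ ?_
  · rintro T s' ⟨i, k, -, -, -, h, -⟩ -
    omega
  · rintro T s' ⟨i, k, h1, h2, h3, h4, h5, h6⟩ - he
    rw [Ne, Expr.eval_lt_eq_zero hw] at he
    simp only [Expr.eval_one, Expr.eval_var, h1, Nat.mod_eq_of_lt hw, not_le] at he
    obtain ⟨k, rfl⟩ : ∃ k', k = k' + 1 := by
      cases k with
      | zero => omega
      | succ k => exact ⟨k, rfl⟩
    have hk : i / 2 < 2 ^ (k + 1) := by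
      rw [pow_succ] at h3
      omega
    simp (disch := omega) [h1, Nat.mod_eq_of_lt, Expr.eval_lt_eq_zero hw, -Expr.eval_lt]
    have hle : ∀ j, n ≤ j → ∀ x, Function.update (s'.arr 8) (i / 2) x j = s.arr 8 j := by
      intro j hj x
      rw [Function.update_of_ne (by omega), h6 j hj]
    exact ⟨fun hlt => ⟨by omega, k, hk, by omega, h5.update_inner (by omega) (by omega),
        fun j hj => hle j hj _⟩,
      fun hlt => ⟨by omega, k, hk, by omega, h5.update_inner (by omega) (by omega),
        fun j hj => hle j hj _⟩⟩
  · rintro T s' ⟨i, k, h1, h2, h3, h4, h5, h6⟩ - he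
    simp (disch := omega) only [Expr.eval_lt_eq_zero hw, Expr.eval_one, Expr.eval_var, h1,
      Nat.mod_eq_of_lt] at he
    simp only [Expr.cost_op, Expr.cost_one, Expr.cost_var]
    exact ⟨by omega, fun j a b c => h5 j a b (by omega), h6⟩

/-- Walk from the root of the tournament tree to a minimal leaf; its position is left in the
variable `7`. -/
def descend : Cmd :=
  .assign 7 1 ;;
  .loop (.op .lt (.var 7) (.var 0))
    (.assign 7 (2 * .var 7 + 1 - .op .eq (.get 8 (2 * .var 7)) (.get 8 (.var 7))))

theorem run_descend {n l : ℕ} {s : State} (hn : 2 * n + 2 < 2 ^ w) (hv : s.var 0 = n)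
    (hn0 : 1 ≤ n) (hl : 2 * n ≤ 2 ^ l) (hT : IsTree n 0 (s.arr 8)) :
    Run w ω descend s (fun t s' => t ≤ 18 * l + 6 ∧ n ≤ s'.var 7 ∧ s'.var 7 < 2 * n ∧
      ∀ j, n ≤ j → j < 2 * n → s.arr 8 (s'.var 7) ≤ s.arr 8 j) := by
  have hw : 1 < 2 ^ w := by omega
  simp only [descend, run_seq, run_assign]
  -- The current position always carries the value of the root, and `2 ^ k ≤ i` shows that it lies
  -- at depth at least `k`.
  refine Run.loop (fun T s' => ∃ i k, s'.var 7 = i ∧ 1 ≤ i ∧ i < 2 * n ∧ 2 ^ k ≤ i ∧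
    T ≤ 18 * k ∧ s'.arr 8 i = s.arr 8 1)
    (18 * l) ⟨1, 0, ?_, le_rfl, by omega, by simp, by omega, rfl⟩ ?_ ?_ ?_
  · simp [Nat.mod_eq_of_lt hw]
  · rintro T s' ⟨i, k, -, -, h3, h4, h5, -⟩ -
    have : k < l := (Nat.pow_lt_pow_iff_right (a := 2) (by omega)).1 (by omega)
    omega
  · rintro T s' ⟨i, k, h1, h2, h3, h4, h5, h6⟩ hF he
    have hv' : s'.var 0 = n := by rw [hF.var 0 rfl]; simpa using hv
    have ha : s'.arr 8 = s.arr 8 := by rw [hF.arr 8 rfl]; simp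
    rw [ha] at h6
    simp only [Ne, Expr.eval_lt_eq_zero hw, Expr.eval_var, h1, hv', not_le] at he
    have ht := hT i h2 he (by omega)
    -- A node is the minimum of its children, so if the left child has another value then the right
    -- child has the value of the node.
    by_cases hc : s.arr 8 (2 * i) = s.arr 8 i
    · simp (disch := omega) only [run_assign, Expr.eval_sub, Expr.eval_add, Expr.eval_mul,
        Expr.eval_var, Expr.eval_one, Expr.eval_two, Expr.eval_eq, Expr.eval_get, h1, ha,
        Nat.mod_eq_of_lt, if_pos hc, State.var_setVar, State.arr_setVar]
      refine ⟨2 * i, k + 1, ?_, by omega, by omega, by rw [pow_succ]; omega, ?_, by rw [hc, h6]⟩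
      · rw [if_pos trivial]; omega
      · simp
        omega
    · simp (disch := omega) only [run_assign, Expr.eval_sub, Expr.eval_add, Expr.eval_mul,
        Expr.eval_var, Expr.eval_one, Expr.eval_two, Expr.eval_eq, Expr.eval_get, h1, ha,
        Nat.mod_eq_of_lt, if_neg hc, State.var_setVar, State.arr_setVar]
      refine ⟨2 * i + 1, k + 1, ?_, by omega, by omega, by rw [pow_succ]; omega, ?_, ?_⟩
      · rw [if_pos trivial]; omega
      · simp
        omega
      · rw [← h6]; omega
  · rintro T s' ⟨i, k, h1, h2, h3, h4, h5, h6⟩ hF he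
    have hv' : s'.var 0 = n := by rw [hF.var 0 rfl]; simpa using hv
    have ha : s'.arr 8 = s.arr 8 := by rw [hF.arr 8 rfl]; simp
    rw [ha] at h6
    simp only [Expr.eval_lt_eq_zero hw, Expr.eval_var, h1, hv'] at he
    have : k < l := (Nat.pow_lt_pow_iff_right (a := 2) (by omega)).1 (by omega)
    simp only [Expr.cost_op, Expr.cost_one, Expr.cost_var, h1]
    exact ⟨by omega, he, h3, fun j _ hj => by rw [h6]; exact hT.root_le (by omega) hj⟩

end WordRAM

namespace WDigraph

variable {n m : ℕ}

/-! ## Shortest paths from one source -/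

/-- The invariant of the shortest path algorithm: `δ` are the tentative distances from `a` and `X`
are the settled nodes. -/
structure Tentative (G : WDigraph n m) (B : ℕ) (a : Fin n) (δ : Fin n → ℕ) (X : Finset (Fin n)) :
    Prop where
  source : δ a = 0
  le : ∀ v, δ v ≤ B
  walk : ∀ v, δ v = B ∨ G.Walk a v (δ v)
  relaxed : ∀ e, G.src e ∈ X → δ (G.dst e) ≤ δ (G.src e) + G.wt e
  ordered : ∀ x ∈ X, ∀ v ∉ X, δ x ≤ δ v

/-- The invariant while the edges out of the last settled node `u` are relaxed; the edges from
`c` on are done. -/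
structure Relaxing (G : WDigraph n m) (B : ℕ) (a : Fin n) (δ : Fin n → ℕ) (X : Finset (Fin n))
    (u : Fin n) (c : ℕ) : Prop where
  source : δ a = 0
  le : ∀ v, δ v ≤ B
  walk : ∀ v, δ v = B ∨ G.Walk a v (δ v)
  relaxed : ∀ e, G.src e ∈ X → (G.src e = u → c ≤ e) →
    δ (G.dst e) ≤ δ (G.src e) + G.wt e
  mem : u ∈ X
  le_last : ∀ x ∈ X, δ x ≤ δ u
  last_le : ∀ v ∉ X, δ u ≤ δ v

variable {G : WDigraph n m} {B : ℕ} {a u : Fin n} {δ : Fin n → ℕ} {X : Finset (Fin n)} {c : ℕ}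

theorem Tentative.init (G : WDigraph n m) (B : ℕ) (a : Fin n) :
    G.Tentative B a (Function.update (fun _ => B) a 0) ∅ where
  source := Function.update_self ..
  le v := by by_cases h : v = a <;> simp [h]
  walk v := by
    by_cases h : v = a
    · subst h; right; simpa using Walk.nil v
    · simp [h]
  relaxed := by simp
  ordered := by simp

theorem Tentative.eq_capDist (h : G.Tentative B a δ Finset.univ) (v : Fin n) :
    δ v = G.capDist B a v :=
  capDist_eq h.source h.le h.walk (fun e => h.relaxed e (Finset.mem_univ _)) v

/-- By `ordered`, the new node is no closer than any settled one. All its edges lie below `lastEdge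
u m`, so none of them is claimed to be relaxed yet. -/
theorem Tentative.settle (h : G.Tentative B a δ X) (hu : u ∉ X)
    (hmin : ∀ v ∉ X, δ u ≤ δ v) : G.Relaxing B a δ (insert u X) u (G.lastEdge u m) where
  source := h.source
  le := h.le
  walk := h.walk
  relaxed e he hc := by
    rcases Finset.mem_insert.1 he with h1 | h1
    · have := G.lt_lastEdge e.2 (congrArg Fin.val h1)
      have := hc h1
      omega
    · exact h.relaxed e h1
  mem := Finset.mem_insert_self _ _
  le_last x hx := by
    rcases Finset.mem_insert.1 hx with rfl | h1
    · exact le_rfl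
    · exact h.ordered x h1 u hu
  last_le v hv := hmin v fun h1 => hv (Finset.mem_insert_of_mem h1)

theorem Relaxing.finish (h : G.Relaxing B a δ X u 0) : G.Tentative B a δ X where
  source := h.source
  le := h.le
  walk := h.walk
  relaxed e he := h.relaxed e he fun _ => Nat.zero_le _
  ordered x hx v hv := (h.le_last x hx).trans (h.last_le v hv)

/-- Position `c + 1` announces edge `c`, and lists run downwards. After edge `c` the next pending
edge out of `u` is the one just below `lastEdge u c`. -/
theorem Relaxing.skip (h : G.Relaxing B a δ X u (c + 1)) (hc : c < m) (hs : G.src ⟨c, hc⟩ = u)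
    (hle : δ (G.dst ⟨c, hc⟩) ≤ δ u + G.wt ⟨c, hc⟩) : G.Relaxing B a δ X u (G.lastEdge u c) where
  source := h.source
  le := h.le
  walk := h.walk
  relaxed e he hl := by
    by_cases h1 : G.src e = u
    · by_cases h2 : (e : ℕ) < c
      · have := G.lt_lastEdge h2 (congrArg Fin.val h1)
        have := hl h1
        omega
      · by_cases h3 : (e : ℕ) = c
        · obtain rfl : e = ⟨c, hc⟩ := Fin.ext h3
          rw [hs]
          exact hle
        · exact h.relaxed e he fun _ => by omega
    · exact h.relaxed e he fun h2 => absurd h2 h1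
  mem := h.mem
  le_last := h.le_last
  last_le := h.last_le

theorem Relaxing.notMem (h : G.Relaxing B a δ X u c) {v : Fin n} (hlt : δ u < δ v) : v ∉ X :=
  fun hv => absurd (h.le_last v hv) (by omega)

/-- Weights are nonnegative and settled nodes have values at most `δ u`, so a strict improvement
only affects an unsettled node. The settled values stay put, and after the update the edge counts as
relaxed. -/
theorem Relaxing.relax (h : G.Relaxing B a δ X u (c + 1)) (hc : c < m) (hs : G.src ⟨c, hc⟩ = u)
    (hlt : δ u + G.wt ⟨c, hc⟩ < δ (G.dst ⟨c, hc⟩)) :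
    G.Relaxing B a (Function.update δ (G.dst ⟨c, hc⟩) (δ u + G.wt ⟨c, hc⟩)) X u
      (G.lastEdge u c) := by
  have hv : G.dst ⟨c, hc⟩ ∉ X := h.notMem (by omega)
  have hX : ∀ x ∈ X, Function.update δ (G.dst ⟨c, hc⟩) (δ u + G.wt ⟨c, hc⟩) x = δ x := by
    intro x hx
    exact Function.update_of_ne (by rintro rfl; exact hv hx) _ _
  have hle : ∀ x, Function.update δ (G.dst ⟨c, hc⟩) (δ u + G.wt ⟨c, hc⟩) x ≤ δ x := by
    intro x
    by_cases h1 : x = G.dst ⟨c, hc⟩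
    · subst h1; rw [Function.update_self]; omega
    · rw [Function.update_of_ne h1]
  have h1 : G.Relaxing B a (Function.update δ (G.dst ⟨c, hc⟩) (δ u + G.wt ⟨c, hc⟩)) X u
      (c + 1) := by
    refine ⟨?_, fun v => (hle v).trans (h.le v), fun v => ?_, fun e he hl => ?_, h.mem,
      fun x hx => ?_, fun v hv' => ?_⟩
    · have := hle a; have := h.source; omega
    · by_cases h1 : v = G.dst ⟨c, hc⟩
      · subst h1
        rw [Function.update_self]
        right
        -- If `δ u` were the cap, no value could exceed it and there would be nothing to improve.
        rcases h.walk u with h2 | h2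
        · have := h.le (G.dst ⟨c, hc⟩); omega
        · exact Walk.snoc (G := G) ⟨c, hc⟩ (by rw [hs]; exact h2)
      · rw [Function.update_of_ne h1]; exact h.walk v
    · rw [hX _ he]
      exact (hle _).trans (h.relaxed e he hl)
    · rw [hX _ hx, hX _ h.mem]; exact h.le_last x hx
    · rw [hX _ h.mem]
      by_cases h1 : v = G.dst ⟨c, hc⟩
      · subst h1; rw [Function.update_self]; omega
      · rw [Function.update_of_ne h1]; exact h.last_le v hv'
  exact h1.skip hc hs (by rw [Function.update_self, hX _ h.mem])

end WDigraph

namespace WordRAM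

variable {w : ℕ} {ω : ℕ → Fin (2 ^ w)} {n m : ℕ}

/-! ## Shortest paths on the word RAM -/

/-- The graph `G` is stored as linked lists of edges in the arrays `hd` and `nx`, with heads of
edges in `tg` and weights in `2`; the variable `3` holds the cap on distances. -/
structure Stored (G : WDigraph n m) (B hd nx tg : ℕ) (s : State) : Prop where
  nodes : s.var 0 = n
  cap : s.var 3 = B
  target : ∀ e : Fin m, s.arr tg e = G.dst e
  weight : ∀ e : Fin m, s.arr 2 e = G.wt e
  head : ∀ u : Fin n, s.arr hd u = G.lastEdge u m
  next : ∀ e : Fin m, s.arr nx e = G.lastEdge (G.src e) e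

theorem Stored.congr {G : WDigraph n m} {B hd nx tg : ℕ} {s s' : State}
    (h : Stored G B hd nx tg s) (h0 : s'.var 0 = s.var 0) (h3 : s'.var 3 = s.var 3)
    (ht : s'.arr tg = s.arr tg) (hw : s'.arr 2 = s.arr 2) (hh : s'.arr hd = s.arr hd)
    (hn : s'.arr nx = s.arr nx) : Stored G B hd nx tg s' :=
  ⟨h0.trans h.nodes, h3.trans h.cap, ht ▸ h.target, hw ▸ h.weight, hh ▸ h.head, hn ▸ h.next⟩

/-- The arrays `7` and `8` hold the tentative distances `δ` and the tournament tree in which the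
nodes of `X` are settled. -/
structure Holds (B : ℕ) (δ : Fin n → ℕ) (X : Finset (Fin n)) (s : State) : Prop where
  dist : ∀ v : Fin n, s.arr 7 v = δ v
  leaf : ∀ v : Fin n, s.arr 8 (n + v) = if v ∈ X then B + 1 else δ v
  tree : IsTree n 0 (s.arr 8)

theorem Holds.congr {B : ℕ} {δ : Fin n → ℕ} {X : Finset (Fin n)} {s s' : State}
    (h : Holds B δ X s) (h7 : s'.arr 7 = s.arr 7) (h8 : s'.arr 8 = s.arr 8) : Holds B δ X s' :=
  ⟨h7 ▸ h.dist, h8 ▸ h.leaf, h8 ▸ h.tree⟩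

/-- Relax the edge before the position in the variable `9`, and move to the next one. -/
def relaxEdge (nx tg : ℕ) : Cmd :=
  .assign 10 (.get tg (.var 9 - 1)) ;;
  .assign 11 (.get 7 (.var 8) + .get 2 (.var 9 - 1)) ;;
  .branch (.op .lt (.var 11) (.get 7 (.var 10)))
    (.store 7 (.var 10) (.var 11) ;;
      .assign 7 (.var 0 + .var 10) ;;
      .store 8 (.var 7) (.var 11) ;;
      sift)
    .skip ;;
  .assign 9 (.get nx (.var 9 - 1))

/-- Settle the closest unsettled node and relax its edges. -/
def settleNext (hd nx tg : ℕ) : Cmd :=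
  descend ;;
  .assign 8 (.var 7 - .var 0) ;;
  .store 8 (.var 7) (.var 3 + 1) ;;
  sift ;;
  .assign 9 (.get hd (.var 8)) ;;
  .loop (.op .lt 0 (.var 9)) (relaxEdge nx tg)

/-- Compute into the array `7` the distances from the node in the variable `4`. -/
def shortestPaths (hd nx tg : ℕ) : Cmd :=
  .forUpTo 5 (.var 0) (.store 7 (.var 5) (.var 3)) ;;
  .forUpTo 5 (2 * .var 0) (.store 8 (.var 5) (.var 3)) ;;
  .store 7 (.var 4) 0 ;;
  .assign 7 (.var 0 + .var 4) ;;
  .store 8 (.var 7) 0 ;;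
  sift ;;
  .forUpTo 6 (.var 0) (settleNext hd nx tg)

/-- The sum of a tentative distance and a weight is at most `B + W`, hence does not overflow. The
list arrays must differ from `7` and `8`, the arrays being written. -/
theorem run_relaxEdge {G : WDigraph n m} {B hd nx tg W l : ℕ} {s : State}
    (hW : ∀ e, G.wt e ≤ W) (hov : B + W + 2 < 2 ^ w) (hn : 2 * n + 2 < 2 ^ w) (hm : m + 2 < 2 ^ w)
    (hl : 2 * n ≤ 2 ^ (l + 1)) (hnx : nx ≠ 8) (hnx' : nx ≠ 7)
    (hS : Stored G B hd nx tg s) {a u : Fin n} {δ : Fin n → ℕ} {X : Finset (Fin n)} {c : ℕ}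
    (hu : s.var 8 = u) (hc : c < m) (hcv : s.var 9 = c + 1) (hs : G.src ⟨c, hc⟩ = u)
    (hH : Holds B δ X s) (hR : G.Relaxing B a δ X u (c + 1)) :
    Run w ω (relaxEdge nx tg) s (fun t s' => t ≤ 33 * l + 50 ∧ s'.var 9 = G.lastEdge u c ∧
      ∃ δ', Holds B δ' X s' ∧ G.Relaxing B a δ' X u (G.lastEdge u c)) := by
  have hw : 1 < 2 ^ w := by omega
  have e1 : s.arr tg c = G.dst ⟨c, hc⟩ := hS.target ⟨c, hc⟩
  have e2 : s.arr 2 c = G.wt ⟨c, hc⟩ := hS.weight ⟨c, hc⟩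
  have e3 : s.arr nx c = G.lastEdge u c := by rw [hS.next ⟨c, hc⟩, hs]
  have e4 := hH.dist u
  have e5 := hH.dist (G.dst ⟨c, hc⟩)
  have b1 := hR.le u
  have b2 := hW ⟨c, hc⟩
  have b3 := (G.dst ⟨c, hc⟩).2
  simp (disch := omega) [relaxEdge, hcv, hu, e1, e2, e4, e5, Nat.mod_eq_of_lt,
    Expr.eval_lt_eq_zero hw, -Expr.eval_lt, hS.nodes]
  constructor
  · intro hlt
    have hv := hR.notMem (v := G.dst ⟨c, hc⟩) (by omega)
    refine (run_sift (n := n) (i := n + G.dst ⟨c, hc⟩) (l := l) hn (by simp) (by omega) (by omega)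
      ?_).conseq ?_
    · simpa using hH.tree.update_leaf (by omega) _
    · rintro t s' ⟨h1, h2, h3⟩ hF
      have f9 : s'.var 9 = c + 1 := by rw [hF.var 9 rfl]; simpa using hcv
      have fnx : s'.arr nx = s.arr nx := by
        rw [hF.arr nx (by simp [sift, Cmd.wa, hnx])]; simp [hnx, hnx']
      have f7 : s'.arr 7 = Function.update (s.arr 7) (G.dst ⟨c, hc⟩) (δ u + G.wt ⟨c, hc⟩) := by
        rw [hF.arr 7 rfl]; simp
      simp (disch := omega) [f9, Nat.mod_eq_of_lt, fnx, e3]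
      refine ⟨by omega, _, ⟨?_, ?_, h2⟩, hR.relax hc hs hlt⟩
      · intro v
        simp only [State.arr_setVar, f7, Function.update_apply, Fin.val_inj, hH.dist]
      · intro v
        rw [State.arr_setVar, h3 _ (by omega)]
        simp only [State.arr_setVar, State.arr_setArr, if_true, Function.update_apply,
          Nat.add_left_cancel_iff, Fin.val_inj]
        by_cases hv' : v = G.dst ⟨c, hc⟩
        · rw [if_pos hv', hv', if_neg hv]; simp
        · simpa [hv'] using hH.leaf v
  · intro hle
    simp [e3]
    exact ⟨δ, hH.congr rfl rfl, hR.skip hc hs hle⟩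

theorem run_settleNext {G : WDigraph n m} {B hd nx tg W l : ℕ} {s : State}
    (hW : ∀ e, G.wt e ≤ W) (hov : B + W + 2 < 2 ^ w) (hn : 2 * n + 2 < 2 ^ w) (hm : m + 2 < 2 ^ w)
    (hl : 2 * n ≤ 2 ^ (l + 1)) (htg : tg ≠ 8) (hnx : nx ≠ 8) (htg' : tg ≠ 7) (hnx' : nx ≠ 7)
    (hhd : hd ≠ 7) (hhd' : hd ≠ 8)
    (hS : Stored G B hd nx tg s) {a : Fin n} {δ : Fin n → ℕ} {X : Finset (Fin n)}
    (hH : Holds B δ X s) (hX : X.card < n) (hT : G.Tentative B a δ X) :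
    Run w ω (settleNext hd nx tg) s (fun t s' => ∃ δ' u, u ∉ X ∧ Holds B δ' (insert u X) s' ∧
      G.Tentative B a δ' (insert u X) ∧ t ≤ 51 * l + 60 + (33 * l + 60) * G.outCount u m) := by
  have hw : 1 < 2 ^ w := by omega
  simp only [settleNext, run_seq]
  refine (run_descend (n := n) (l := l + 1) hn hS.nodes (by omega) hl hH.tree).conseq ?_
  rintro t₁ s₁ ⟨ht₁, h1, h2, h3⟩ hF₁
  obtain ⟨i, hi⟩ : ∃ i, s₁.var 7 = i := ⟨_, rfl⟩
  rw [hi] at h1 h2 h3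
  obtain ⟨u, rfl⟩ : ∃ u : Fin n, i = n + u := ⟨⟨i - n, by omega⟩, by simp; omega⟩
  have a8 : s₁.arr 8 = s.arr 8 := hF₁.arr 8 rfl
  have a7 : s₁.arr 7 = s.arr 7 := hF₁.arr 7 rfl
  have v0 : s₁.var 0 = n := (hF₁.var 0 rfl).trans hS.nodes
  have v3 : s₁.var 3 = B := (hF₁.var 3 rfl).trans hS.cap
  -- Settled leaves hold `B + 1`, above every tentative distance, so the minimal leaf is unsettled
  -- as long as any node is.
  have hmin : ∀ v ∉ X, u ∉ X ∧ δ u ≤ δ v := by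
    intro v hv
    have h4 := h3 (n + v) (by omega) (by omega)
    rw [hH.leaf, hH.leaf, if_neg hv] at h4
    have := hT.le v
    split_ifs at h4 with h5
    · omega
    · exact ⟨h5, h4⟩
  obtain ⟨v₀, hv₀⟩ : ∃ v, v ∉ X := by
    by_contra! hc
    have : X = Finset.univ := Finset.eq_univ_iff_forall.2 hc
    rw [this, Finset.card_univ, Fintype.card_fin] at hX
    omega
  have hu := (hmin v₀ hv₀).1
  have hR := hT.settle hu fun v hv => (hmin v hv).2
  have eu : n + (u : ℕ) - n = u := by omega
  simp (disch := omega) only [run_assign, run_store, Expr.eval_sub, Expr.eval_add, Expr.eval_var,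
    Expr.eval_one, State.var_setVar, hi, v0, v3, Nat.mod_eq_of_lt, eu, Nat.reduceEqDiff, if_false]
  refine (run_sift (n := n) (i := n + u) (l := l) hn (by simpa using hi) (by omega)
    (by omega) ?_).conseq ?_
  · simpa [a8] using hH.tree.update_leaf (by omega) _
  rintro t₂ s₂ ⟨ht₂, h4, h5⟩ hF₂
  have v8 : s₂.var 8 = u := by rw [hF₂.var 8 rfl]; simp
  have hS₂ : Stored G B hd nx tg s₂ := by
    refine hS.congr ?_ ?_ ?_ ?_ ?_ ?_
    · rw [hF₂.var 0 rfl]; simp [v0, hS.nodes]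
    · rw [hF₂.var 3 rfl]; simp [v3, hS.cap]
    · rw [hF₂.arr tg (by simp [sift, Cmd.wa, htg])]
      simp [htg, hF₁.arr tg (by simp [descend, Cmd.wa])]
    · rw [hF₂.arr 2 rfl]; simp [hF₁.arr 2 rfl]
    · rw [hF₂.arr hd (by simp [sift, Cmd.wa, hhd'])]
      simp [hhd', hF₁.arr hd (by simp [descend, Cmd.wa])]
    · rw [hF₂.arr nx (by simp [sift, Cmd.wa, hnx])]
      simp [hnx, hF₁.arr nx (by simp [descend, Cmd.wa])]
  have hH₂ : Holds B δ (insert u X) s₂ := by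
    refine ⟨fun v => ?_, fun v => ?_, h4⟩
    · rw [hF₂.arr 7 rfl]; simp [a7, hH.dist]
    · rw [h5 _ (by omega)]
      simp only [State.arr_setVar, State.arr_setArr, if_true, Function.update_apply,
          Nat.add_left_cancel_iff, Fin.val_inj, a8, Finset.mem_insert, hH.leaf]
      by_cases hv' : v = u <;> simp [hv']
  have hhead := hS₂.head u
  simp only [Expr.eval_get, Expr.eval_var, v8, hhead]
  -- The number `outCount u c` of pending edges pays for the remaining rounds.
  refine Run.loop (fun T s' => ∃ c δ', s'.var 9 = G.lastEdge u c ∧ Holds B δ' (insert u X) s' ∧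
    G.Relaxing B a δ' (insert u X) u (G.lastEdge u c) ∧ c ≤ m ∧
    T + (33 * l + 60) * G.outCount u c ≤ (33 * l + 60) * G.outCount u m)
    ((33 * l + 60) * G.outCount u m) ⟨m, δ, ?_, hH₂.congr rfl rfl, hR, le_rfl, by omega⟩
    ?_ ?_ ?_
  · simp
  · rintro T s' ⟨c, δ', -, -, -, -, h⟩ -
    exact (Nat.le_add_right _ _).trans h
  · rintro T s' ⟨c, δ', g1, g2, g3, g4, g5⟩ hF he
    simp only [Ne, Expr.eval_lt_eq_zero hw, Expr.eval_var, Expr.eval_zero, not_le, g1] at he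
    obtain ⟨c', hc'⟩ : ∃ c', G.lastEdge u c = c' + 1 := ⟨G.lastEdge u c - 1, by omega⟩
    obtain ⟨hcm, hsrc⟩ := G.src_of_lastEdge hc'
    have hcnt : G.outCount u c = G.outCount u c' + 1 := by
      rw [← G.outCount_lastEdge u c, hc', G.outCount_succ hcm hsrc]
    rw [hc'] at g1 g3
    have hS' : Stored G B hd nx tg s' := by
      refine hS₂.congr ?_ ?_ ?_ ?_ ?_ ?_
      · rw [hF.var 0 rfl]; simp
      · rw [hF.var 3 rfl]; simp
      · rw [hF.arr tg (by simp [relaxEdge, sift, Cmd.wa, htg, htg'])]; simp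
      · rw [hF.arr 2 rfl]; simp
      · rw [hF.arr hd (by simp [relaxEdge, sift, Cmd.wa, hhd, hhd'])]; simp
      · rw [hF.arr nx (by simp [relaxEdge, sift, Cmd.wa, hnx, hnx'])]; simp
    have v8' : s'.var 8 = u := by rw [hF.var 8 rfl]; simpa using v8
    refine (run_relaxEdge hW hov hn hm hl hnx hnx' hS' v8' hcm g1 (Fin.ext hsrc)
      g2 g3).mono ?_
    rintro t s'' ⟨k1, k2, δ'', k3, k4⟩
    refine ⟨c', δ'', k2, k3, k4, hcm.le, ?_⟩
    rw [hcnt] at g5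
    simp only [Expr.cost_op, Expr.cost_zero, Expr.cost_var]
    rw [Nat.mul_add] at g5
    omega
  · rintro T s' ⟨c, δ', g1, g2, g3, g4, g5⟩ hF he
    simp only [Expr.eval_lt_eq_zero hw, Expr.eval_var, Expr.eval_zero, Nat.le_zero, g1] at he
    rw [he] at g3
    refine ⟨δ', u, hu, g2, g3.finish, ?_⟩
    simp only [Expr.cost_op, Expr.cost_zero, Expr.cost_var, Expr.cost_sub, Expr.cost_add,
      Expr.cost_one, Expr.cost_get]
    have := (Nat.le_add_right _ _).trans g5
    omega

/-- Each of the `n` settlings and each of the `m` relaxations in total costs `O(l)`. Unreachable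
nodes are settled as well, with the cap as their value, so there are always exactly `n` rounds. -/
theorem run_shortestPaths {G : WDigraph n m} {B hd nx tg W l : ℕ} {s : State}
    (hW : ∀ e, G.wt e ≤ W) (hov : B + W + 2 < 2 ^ w) (hn : 2 * n + 2 < 2 ^ w) (hm : m + 2 < 2 ^ w)
    (hl : 2 * n ≤ 2 ^ (l + 1)) (htg : tg ≠ 8) (hnx : nx ≠ 8) (htg' : tg ≠ 7) (hnx' : nx ≠ 7)
    (hhd : hd ≠ 7) (hhd' : hd ≠ 8)
    (hS : Stored G B hd nx tg s) {a : Fin n} (ha : s.var 4 = a) :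
    Run w ω (shortestPaths hd nx tg) s (fun t s' =>
      t ≤ (n + m + 1) * (84 * l + 200) ∧ ∀ v : Fin n, s'.arr 7 v = G.capDist B a v) := by
  have hw : 1 < 2 ^ w := by omega
  simp only [shortestPaths, run_seq]
  refine (Run.forUpTo (Q := fun t s' => t ≤ 11 * n + 6 ∧ ∀ v, v < n → s'.arr 7 v = B)
    n hw (by omega) rfl
    (fun k T s' => T ≤ 11 * k + 2 ∧ ∀ v, v < k → s'.arr 7 v = B) ?_ (by simp) ?_ ?_).conseq ?_
  · intro s' hF
    rw [Expr.eval_var, hF.var 0 rfl, hS.nodes]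
  · rintro k T s' hk hv hF ⟨hT, hI⟩
    simp [hv, hF.var 3 rfl, hS.cap]
    refine ⟨by omega, fun v hv => ?_⟩
    by_cases h : v = k
    · simp [h]
    · rw [Function.update_of_ne h]; exact hI v (by omega)
  · rintro T s' - ⟨hT, hI⟩
    exact ⟨by simp; omega, hI⟩
  rintro t₁ s₁ ⟨ht₁, h7⟩ hF₁
  refine (Run.forUpTo (Q := fun t s' => t ≤ 26 * n + 8 ∧ ∀ v, v < 2 * n → s'.arr 8 v = B)
    (2 * n) hw (by omega) rfl
    (fun k T s' => T ≤ 13 * k + 2 ∧ ∀ v, v < k → s'.arr 8 v = B) ?_ (by simp) ?_ ?_).conseq ?_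
  · intro s' hF
    simp (disch := omega) only [Expr.eval_mul, Expr.eval_two, Expr.eval_var, hF.var 0 rfl,
      hF₁.var 0 rfl, hS.nodes, Nat.mod_eq_of_lt]
  · rintro k T s' hk hv hF ⟨hT, hI⟩
    simp [hv, hF.var 3 rfl, hF₁.var 3 rfl, hS.cap]
    refine ⟨by omega, fun v hv => ?_⟩
    by_cases h : v = k
    · simp [h]
    · rw [Function.update_of_ne h]; exact hI v (by omega)
  · rintro T s' - ⟨hT, hI⟩
    exact ⟨by simp; omega, hI⟩
  rintro t₂ s₂ ⟨ht₂, h8⟩ hF₂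
  have v4 : s₂.var 4 = a := by rw [hF₂.var 4 rfl, hF₁.var 4 rfl, ha]
  have v0 : s₂.var 0 = n := by rw [hF₂.var 0 rfl, hF₁.var 0 rfl, hS.nodes]
  have a7 : ∀ v, v < n → s₂.arr 7 v = B := by rw [hF₂.arr 7 rfl]; exact h7
  have hT0 : IsTree n 0 (s₂.arr 8) := by
    intro j _ h2 _
    rw [h8 _ (by omega), h8 _ (by omega), h8 _ (by omega), min_self]
  simp (disch := omega) only [run_store, run_assign, Expr.eval_add, Expr.eval_var, Expr.eval_zero,
    State.var_setVar, State.var_setArr, v0, v4, Nat.mod_eq_of_lt, if_true]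
  refine (run_sift (n := n) (i := n + a) (l := l) hn (by simp) (by omega)
    (by omega) ?_).conseq ?_
  · simpa using hT0.update_leaf (by omega) _
  rintro t₃ s₃ ⟨ht₃, h4, h5⟩ hF₃
  have hS₃ : Stored G B hd nx tg s₃ := by
    refine hS.congr ?_ ?_ ?_ ?_ ?_ ?_
    · rw [hF₃.var 0 rfl]; simp [v0, hS.nodes]
    · rw [hF₃.var 3 rfl]; simp [hF₂.var 3 rfl, hF₁.var 3 rfl]
    · rw [hF₃.arr tg (by simp [sift, Cmd.wa, htg])]
      simp [htg, htg', hF₁.arr tg (by simp [Cmd.forUpTo, Cmd.wa, htg']),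
        hF₂.arr tg (by simp [Cmd.forUpTo, Cmd.wa, htg])]
    · rw [hF₃.arr 2 rfl]; simp [hF₂.arr 2 rfl, hF₁.arr 2 rfl]
    · rw [hF₃.arr hd (by simp [sift, Cmd.wa, hhd'])]
      simp [hhd, hhd', hF₁.arr hd (by simp [Cmd.forUpTo, Cmd.wa, hhd]),
        hF₂.arr hd (by simp [Cmd.forUpTo, Cmd.wa, hhd'])]
    · rw [hF₃.arr nx (by simp [sift, Cmd.wa, hnx])]
      simp [hnx, hnx', hF₁.arr nx (by simp [Cmd.forUpTo, Cmd.wa, hnx']),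
        hF₂.arr nx (by simp [Cmd.forUpTo, Cmd.wa, hnx])]
  have hH₃ : Holds B (Function.update (fun _ => B) a 0) ∅ s₃ := by
    refine ⟨fun v => ?_, fun v => ?_, h4⟩
    · rw [hF₃.arr 7 rfl]
      simp [Function.update_apply, Fin.val_inj, a7]
    · rw [h5 _ (by omega)]
      simp [Function.update_apply, Fin.val_inj]
      rw [h8 _ (by omega)]
  refine Run.forUpTo n hw (by omega) (by rfl)
    (fun k T s' => ∃ δ X, Holds B δ X s' ∧ G.Tentative B a δ X ∧ X.card = k ∧
      T ≤ (51 * l + 70) * k + (33 * l + 60) * ∑ u ∈ X, G.outCount u m + 2) ?_ ?_ ?_ ?_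
  · intro s' hF
    rw [Expr.eval_var, hF.var 0 rfl, hS₃.nodes]
  · exact ⟨_, ∅, hH₃.congr rfl rfl, .init G B a, rfl, by simp⟩
  · rintro k T s' hk hv hF ⟨δ, X, g1, g2, g3, g4⟩
    have hS' : Stored G B hd nx tg s' := by
      refine hS₃.congr (hF.var 0 rfl) (hF.var 3 rfl) ?_ (hF.arr 2 rfl) ?_ ?_
      · exact hF.arr tg (by simp [Cmd.forUpTo, settleNext, descend, relaxEdge, sift,
          Cmd.wa, htg, htg'])
      · exact hF.arr hd (by simp [Cmd.forUpTo, settleNext, descend, relaxEdge, sift,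
          Cmd.wa, hhd, hhd'])
      · exact hF.arr nx (by simp [Cmd.forUpTo, settleNext, descend, relaxEdge, sift,
          Cmd.wa, hnx, hnx'])
    refine (run_settleNext hW hov hn hm hl htg hnx htg' hnx' hhd hhd' hS' g1 (by omega) g2).mono ?_
    rintro t s'' ⟨δ', u, hu, k1, k2, k3⟩
    refine ⟨δ', insert u X, k1.congr rfl rfl, k2, by rw [Finset.card_insert_of_notMem hu, g3], ?_⟩
    rw [Finset.sum_insert hu, Nat.mul_add, Nat.mul_add, Expr.cost_var]
    omega
  · rintro T s' hF ⟨δ, X, g1, g2, g3, g4⟩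
    obtain rfl : X = Finset.univ := by
      rw [← Finset.card_eq_iff_eq_univ, g3, Fintype.card_fin]
    refine ⟨?_, fun v => by rw [g1.dist, g2.eq_capDist]⟩
    rw [G.sum_outCount] at g4
    simp only [Expr.cost_add, Expr.cost_var, Expr.cost_zero]
    nlinarith

end WordRAM

namespace WordRAM

variable {w : ℕ} {ω : ℕ → Fin (2 ^ w)} {n m : ℕ}

/-! ## Parts of the radius algorithm -/

/-- Store the maximum weight in the variable `2`. -/
def maxWeight : Cmd :=
  .assign 2 0 ;;
  .forUpTo 16 (.var 1) (.branch (.op .lt (.var 2) (.get 2 (.var 16)))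
    (.assign 2 (.get 2 (.var 16))) .skip)

theorem run_maxWeight {G : WDigraph n m} {M : ℕ} {s : State} (hM : ∀ e, G.wt e ≤ M)
    (hm : m + 2 < 2 ^ w) (h1 : s.var 1 = m) (h2 : ∀ e : Fin m, s.arr 2 e = G.wt e) :
    Run w ω maxWeight s (fun t s' => t ≤ 17 * m + 8 ∧ (∀ e, G.wt e ≤ s'.var 2) ∧ s'.var 2 ≤ M) := by
  have hw : 1 < 2 ^ w := by omega
  simp only [maxWeight, run_seq, run_assign]
  refine Run.forUpTo m hw (by omega) rfl
    (fun k T s' => T ≤ 17 * k + 2 ∧ (∀ e : Fin m, (e : ℕ) < k → G.wt e ≤ s'.var 2) ∧ s'.var 2 ≤ M)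
    ?_ (by simp) ?_ ?_
  · intro s' hF
    rw [Expr.eval_var, hF.var 1 rfl]
    simpa using h1
  · rintro k T s' hk hv hF ⟨hT, hI, hI'⟩
    have h3 : s'.arr 2 k = G.wt ⟨k, hk⟩ := by rw [hF.arr 2 rfl]; exact h2 ⟨k, hk⟩
    have h4 := hM ⟨k, hk⟩
    have key : ∀ V, s'.var 2 ≤ V → G.wt ⟨k, hk⟩ ≤ V →
        ∀ e : Fin m, (e : ℕ) ≤ k → G.wt e ≤ V := by
      intro V hV hV' e he
      by_cases h : (e : ℕ) = k
      · obtain rfl : e = ⟨k, hk⟩ := Fin.ext h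
        exact hV'
      · exact (hI e (by omega)).trans hV
    simp [hv, h3, Expr.eval_lt_eq_zero hw, -Expr.eval_lt]
    exact ⟨fun h => ⟨by omega, key _ h.le le_rfl, h4⟩, fun h => ⟨by omega, key _ le_rfl h, hI'⟩⟩
  · rintro T s' - ⟨hT, hI, hI'⟩
    exact ⟨by simp; omega, fun e => hI e e.2, hI'⟩

/-- Build linked lists of the edges with the same entry in the array `sr`. -/
def buildLists (sr hd nx : ℕ) : Cmd :=
  .forUpTo 16 (.var 1)
    (.store nx (.var 16) (.get hd (.get sr (.var 16))) ;;
      .store hd (.get sr (.var 16)) (.var 16 + 1))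

theorem run_buildLists {G : WDigraph n m} {sr hd nx : ℕ} {s : State}
    (hm : m + 2 < 2 ^ w) (h1 : s.var 1 = m) (hsr : ∀ e : Fin m, s.arr sr e = G.src e)
    (hhd : ∀ u : Fin n, s.arr hd u = 0) (hd1 : sr ≠ hd) (hd2 : sr ≠ nx) (hd3 : hd ≠ nx) :
    Run w ω (buildLists sr hd nx) s (fun t s' => t ≤ 22 * m + 6 ∧
      (∀ u : Fin n, s'.arr hd u = G.lastEdge u m) ∧
      (∀ e : Fin m, s'.arr nx e = G.lastEdge (G.src e) e)) := by
  have hw : 1 < 2 ^ w := by omega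
  refine Run.forUpTo m hw (by omega) rfl
    (fun k T s' => T ≤ 22 * k + 2 ∧ (∀ u : Fin n, s'.arr hd u = G.lastEdge u k) ∧
      (∀ e : Fin m, (e : ℕ) < k → s'.arr nx e = G.lastEdge (G.src e) e)) ?_ ?_ ?_ ?_
  · intro s' hF
    rw [Expr.eval_var, hF.var 1 rfl]
    exact h1
  · exact ⟨le_rfl, fun u => by simpa [WDigraph.lastEdge] using hhd u, by simp⟩
  · rintro k T s' hk hv hF ⟨hT, hI, hI'⟩
    have h3 : s'.arr sr k = G.src ⟨k, hk⟩ := by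
      rw [hF.arr sr (by simp [Cmd.forUpTo, Cmd.wa, hd1, hd2])]; exact hsr ⟨k, hk⟩
    simp (disch := omega) [hv, h3, hd2, hd3, Nat.mod_eq_of_lt, hI]
    refine ⟨by omega, fun u => ?_, fun e he => ?_⟩
    · rw [WDigraph.lastEdge, dif_pos hk]
      by_cases h : u = G.src ⟨k, hk⟩
      · subst h; simp
      · rw [Function.update_of_ne (by simpa [Fin.val_inj] using h),
          if_neg (by simpa [Fin.val_inj, eq_comm] using h), hI]
    · simp only [hd3.symm, if_false]
      by_cases h : (e : ℕ) = k
      · obtain rfl : e = ⟨k, hk⟩ := Fin.ext h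
        simp
      · rw [Function.update_of_ne h]
        exact hI' e (by omega)
  · rintro T s' - ⟨hT, hI, hI'⟩
    exact ⟨by simp; omega, hI, fun e => hI' e e.2⟩

/-- Store the rounded-up square root of the number of nodes in the variable `12`. -/
def ceilSqrt : Cmd :=
  .assign 12 0 ;;
  .loop (.op .lt (.var 12 * .var 12) (.var 0)) (.assign 12 (.var 12 + 1))

/-- The least `r` with `n ≤ r * r` is `(n - 1).sqrt + 1`. Finding it by counting is affordable,
since linear time is negligible in the total. -/
theorem run_ceilSqrt {s : State} (hn : 2 ≤ n) (hn2 : n * n < 2 ^ w) (h0 : s.var 0 = n) :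
    Run w ω ceilSqrt s (fun t s' => t ≤ 20 * n + 20 ∧
      s'.var 12 = (n - 1).sqrt + 1) := by
  have hw : 1 < 2 ^ w := by nlinarith
  have hs : (n - 1).sqrt ≤ n - 1 := Nat.sqrt_le_self _
  simp only [ceilSqrt, run_seq, run_assign]
  refine Run.loop (fun T s' => T ≤ 10 * s'.var 12 ∧ s'.var 12 ≤ (n - 1).sqrt + 1) (10 * n) (by simp)
    ?_ ?_ ?_
  · rintro T s' ⟨h1, h2⟩ -
    omega
  · rintro T s' ⟨h1, h2⟩ hF he
    have h0' : s'.var 0 = n := by rw [hF.var 0 rfl]; simpa using h0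
    have hq : s'.var 12 * s'.var 12 < 2 ^ w := by
      have : s'.var 12 ≤ n := by omega
      nlinarith
    have hq' : s'.var 12 + 1 < 2 ^ w := by nlinarith
    simp only [Ne, Expr.eval_lt_eq_zero hw, Expr.eval_var, Expr.eval_mul, not_le, h0',
      Nat.mod_eq_of_lt hq] at he
    have := Nat.le_sqrt.2 (Nat.le_sub_one_of_lt he)
    simp [Nat.mod_eq_of_lt hw, Nat.mod_eq_of_lt hq']
    exact ⟨by omega, by omega⟩
  · rintro T s' ⟨h1, h2⟩ hF he
    have h0' : s'.var 0 = n := by rw [hF.var 0 rfl]; simpa using h0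
    have hq : s'.var 12 * s'.var 12 < 2 ^ w := by
      have : s'.var 12 ≤ n := by omega
      nlinarith
    simp only [Expr.eval_lt_eq_zero hw, Expr.eval_var, Expr.eval_mul, h0',
      Nat.mod_eq_of_lt hq] at he
    have h3 : (n - 1).sqrt < s'.var 12 := Nat.sqrt_lt.2 (by omega)
    refine ⟨?_, by omega⟩
    simp
    omega

/-- Store the rounded-up binary logarithm of the number of nodes in the variable `13`. -/
def ceilLog : Cmd :=
  .assign 13 0 ;;
  .assign 14 1 ;;
  .loop (.op .lt (.var 14) (.var 0)) (.assign 14 (2 * .var 14) ;; .assign 13 (.var 13 + 1))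

theorem run_ceilLog {s : State} (hn : 2 ≤ n) (hn2 : 2 * n + 2 < 2 ^ w) (h0 : s.var 0 = n) :
    Run w ω ceilLog s (fun t s' => t ≤ 30 * n + 30 ∧
      s'.var 13 = Nat.clog 2 n) := by
  have hw : 1 < 2 ^ w := by omega
  simp only [ceilLog, run_seq, run_assign]
  refine Run.loop (fun T s' => T ≤ 20 * s'.var 13 ∧ s'.var 14 = 2 ^ s'.var 13 ∧
    2 ^ s'.var 13 < 2 * n ∧ s'.var 13 ≤ n) (20 * n)
    (by simp [Nat.mod_eq_of_lt hw]; omega) ?_ ?_ ?_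
  · rintro T s' ⟨h1, h2, h3, h4⟩ -
    omega
  · rintro T s' ⟨h1, h2, h3, h4⟩ hF he
    have h0' : s'.var 0 = n := by rw [hF.var 0 rfl]; simpa using h0
    simp only [Ne, Expr.eval_lt_eq_zero hw, Expr.eval_var, not_le, h0', h2] at he
    have h5 : s'.var 13 < 2 ^ s'.var 13 := Nat.lt_two_pow_self
    simp (disch := omega) [Nat.mod_eq_of_lt, h2]
    exact ⟨by omega, by rw [pow_succ]; omega, by rw [pow_succ]; omega, by omega⟩
  · rintro T s' ⟨h1, h2, h3, h4⟩ hF he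
    have h0' : s'.var 0 = n := by rw [hF.var 0 rfl]; simpa using h0
    simp only [Expr.eval_lt_eq_zero hw, Expr.eval_var, h0', h2] at he
    have h5 : s'.var 13 < Nat.clog 2 n + 1 := by
      refine (Nat.pow_lt_pow_iff_right (a := 2) (by omega)).1 ?_
      have := Nat.le_pow_clog (b := 2) (by omega) n
      rw [pow_succ]
      omega
    have h6 := Nat.clog_le_of_le_pow he
    refine ⟨?_, by omega⟩
    simp
    omega

/-- Replace each entry of the array `a` by its maximum with the value of `e`, in which the
variable `16` stands for the index. -/
def accumMax (a : ℕ) (e : Expr) : Cmd :=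
  .forUpTo 16 (.var 0) (.branch (.op .lt (.get a (.var 16)) e) (.store a (.var 16) e) .skip)

theorem run_accumMax {a : ℕ} {e : Expr} {f : Fin n → ℕ} {s : State} (hn : 2 * n + 2 < 2 ^ w)
    (h0 : s.var 0 = n)
    (he : ∀ (v : Fin n) (s' : State), s'.var 16 = v → Frame (accumMax a e) s s' →
      e.eval w s' = f v) :
    Run w ω (accumMax a e) s (fun t s' => t ≤ (2 * e.cost + 18) * n + 6 ∧
      ∀ v : Fin n, s'.arr a v = max (s.arr a v) (f v)) := by
  have hw : 1 < 2 ^ w := by omega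
  refine Run.forUpTo n hw (by omega) rfl
    (fun k T s' => T ≤ (2 * e.cost + 18) * k + 2 ∧ ∀ v : Fin n, s'.arr a v =
      if (v : ℕ) < k then max (s.arr a v) (f v) else s.arr a v) ?_ (by simp) ?_ ?_
  · intro s' hF
    rw [Expr.eval_var, hF.var 0 rfl]
    exact h0
  · rintro k T s' hk hv hF ⟨hT, hI⟩
    have h3 : e.eval w s' = f ⟨k, hk⟩ := he ⟨k, hk⟩ s' hv hF
    have h4 : s'.arr a k = s.arr a k := by simpa using hI ⟨k, hk⟩
    simp [hv, h3, h4, Expr.eval_lt_eq_zero hw, -Expr.eval_lt]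
    refine ⟨fun h => ⟨by rw [Nat.mul_add]; omega, fun v => ?_⟩,
      fun h => ⟨by rw [Nat.mul_add]; omega, fun v => ?_⟩⟩
    · by_cases hvk : (v : ℕ) = k
      · obtain rfl : v = ⟨k, hk⟩ := Fin.ext hvk
        simp [h.le]
      · rw [Function.update_of_ne hvk, hI]
        congr 1
        exact propext (by omega)
    · by_cases hvk : (v : ℕ) = k
      · obtain rfl : v = ⟨k, hk⟩ := Fin.ext hvk
        simp [h, h4]
      · rw [hI]
        congr 1
        exact propext (by omega)
  · rintro T s' - ⟨hT, hI⟩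
    exact ⟨by simp; omega, fun v => by simp [hI v]⟩

/-- Store in the variable `17` an index of a least entry of the array `a`. -/
def argmin (a : ℕ) : Cmd :=
  .assign 17 0 ;;
  .forUpTo 16 (.var 0) (.branch (.op .lt (.get a (.var 16)) (.get a (.var 17)))
    (.assign 17 (.var 16)) .skip)

theorem run_argmin {a : ℕ} {s : State} (hn0 : 0 < n) (hn : 2 * n + 2 < 2 ^ w) (h0 : s.var 0 = n) :
    Run w ω (argmin a) s (fun t s' => t ≤ 17 * n + 8 ∧ ∃ x : Fin n, s'.var 17 = x ∧
      ∀ v : Fin n, s.arr a x ≤ s.arr a v) := by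
  have hw : 1 < 2 ^ w := by omega
  simp only [argmin, run_seq, run_assign]
  refine Run.forUpTo n hw (by omega) rfl
    (fun k T s' => T ≤ 17 * k + 2 ∧ ∃ x : Fin n, s'.var 17 = x ∧
      ∀ v : Fin n, (v : ℕ) < k → s.arr a x ≤ s.arr a v) ?_ ?_ ?_ ?_
  · intro s' hF
    rw [Expr.eval_var, hF.var 0 rfl]
    simpa using h0
  · exact ⟨le_rfl, ⟨0, hn0⟩, by simp, by simp⟩
  · rintro k T s' hk hv hF ⟨hT, x, hx, hI⟩
    have h3 : s'.arr a = s.arr a := by rw [hF.arr a rfl]; simp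
    simp [hv, h3, hx, Expr.eval_lt_eq_zero hw, -Expr.eval_lt]
    refine ⟨fun h => ⟨by omega, ⟨k, hk⟩, rfl, fun v hv' => ?_⟩,
      fun h => ⟨by omega, x, rfl, fun v hv' => ?_⟩⟩
    · by_cases hvk : (v : ℕ) = k
      · simp [hvk]
      · exact h.le.trans (hI v (by omega))
    · by_cases hvk : (v : ℕ) = k
      · rw [hvk]; exact h
      · exact hI v (by omega)
  · rintro T s' - ⟨hT, x, hx, hI⟩
    exact ⟨by simp; omega, x, hx, fun v => hI v v.2⟩

/-! ### Distances from and to a node, and the single rounds of the algorithm -/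

/-- The graph is stored in both directions. -/
structure Ready (G : WDigraph n m) (B : ℕ) (s : State) : Prop where
  fwd : Stored G B 3 4 1 s
  bwd : Stored G.reverse B 5 6 0 s

/-- Whether the program leaves alone everything that `Ready` speaks about. -/
def Cmd.keepsGraph (p : Cmd) : Bool :=
  !(p.wv 0 || p.wv 3 || p.wa 0 || p.wa 1 || p.wa 2 || p.wa 3 || p.wa 4 || p.wa 5 || p.wa 6)

theorem Ready.frame {G : WDigraph n m} {B : ℕ} {p : Cmd} {s s' : State} (h : Ready G B s)
    (hF : Frame p s s') (hp : p.keepsGraph = true) : Ready G B s' := by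
  simp only [Cmd.keepsGraph, Bool.not_eq_true', Bool.or_eq_false_iff] at hp
  obtain ⟨⟨⟨⟨⟨⟨⟨⟨h0, h3⟩, a0⟩, a1⟩, a2⟩, a3⟩, a4⟩, a5⟩, a6⟩ := hp
  exact ⟨h.fwd.congr (hF.var _ h0) (hF.var _ h3) (hF.arr _ a1) (hF.arr _ a2) (hF.arr _ a3)
      (hF.arr _ a4),
    h.bwd.congr (hF.var _ h0) (hF.var _ h3) (hF.arr _ a0) (hF.arr _ a2) (hF.arr _ a5)
      (hF.arr _ a6)⟩

/-- The numbers that occur fit into words; the node count is at most `2 ^ l`. -/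
structure Fits (G : WDigraph n m) (w B W l : ℕ) : Prop where
  weight : ∀ e, G.wt e ≤ W
  cap : B + W + 2 < 2 ^ w
  nodes : 2 * n + 2 < 2 ^ w
  edges : m + 2 < 2 ^ w
  log : n ≤ 2 ^ l

/-- Distances from the node in the variable `4`. -/
def distFrom : Cmd := shortestPaths 3 4 1

/-- Distances to the node in the variable `4`. -/
def distTo : Cmd := shortestPaths 5 6 0

theorem run_distFrom {G : WDigraph n m} {B W l : ℕ} {s : State} (hf : Fits G w B W l)
    (hR : Ready G B s) {a : Fin n} (ha : s.var 4 = a) :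
    Run w ω distFrom s (fun t s' =>
      t ≤ (n + m + 1) * (84 * l + 200) ∧ ∀ v : Fin n, s'.arr 7 v = G.capDist B a v) :=
  run_shortestPaths hf.weight hf.cap hf.nodes hf.edges (by have := hf.log; rw [pow_succ]; omega)
    (by decide) (by decide) (by decide) (by decide) (by decide) (by decide) hR.fwd ha

theorem run_distTo {G : WDigraph n m} {B W l : ℕ} {s : State} (hf : Fits G w B W l)
    (hR : Ready G B s) {a : Fin n} (ha : s.var 4 = a) :
    Run w ω distTo s (fun t s' =>
      t ≤ (n + m + 1) * (84 * l + 200) ∧ ∀ v : Fin n, s'.arr 7 v = G.capDist B v a) := by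
  simp only [← G.capDist_reverse B _ a]
  exact run_shortestPaths (G := G.reverse) hf.weight hf.cap hf.nodes hf.edges
    (by have := hf.log; rw [pow_succ]; omega)
    (by decide) (by decide) (by decide) (by decide) (by decide) (by decide) hR.bwd ha

/-- Improve the variable `18` by the largest distance from the node in the variable `4`. -/
def testNode : Cmd :=
  distFrom ;;
  .assign 21 0 ;;
  .forUpTo 16 (.var 0) (.branch (.op .lt (.var 21) (.get 7 (.var 16)))
    (.assign 21 (.get 7 (.var 16))) .skip) ;;
  .branch (.op .lt (.var 21) (.var 18)) (.assign 18 (.var 21)) .skip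

theorem run_testNode {G : WDigraph n m} {B W l : ℕ} {s : State} (hf : Fits G w B W l)
    (hR : Ready G B s) {a : Fin n} (ha : s.var 4 = a) :
    Run w ω testNode s (fun t s' =>
      t ≤ (n + m + 1) * (84 * l + 300) ∧ s'.var 18 = min (s.var 18) (G.capEcc B a)) := by
  have hw : 1 < 2 ^ w := by have := hf.cap; omega
  have hn := hf.nodes
  simp only [testNode, run_seq]
  refine (run_distFrom hf hR ha).conseq ?_
  rintro t₁ s₁ ⟨ht₁, h7⟩ hF₁
  simp only [run_assign, Expr.eval_zero]
  refine (Run.forUpTo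
    (Q := fun t s' => t ≤ 17 * n + 6 ∧ s'.var 21 = G.capEcc B a) n hw (by omega) rfl
    (fun k T s' => T ≤ 17 * k + 2 ∧ s'.var 21 =
      (Finset.univ.filter fun v : Fin n => (v : ℕ) < k).sup fun v => G.capDist B a v)
      ?_ ?_ ?_ ?_).conseq ?_
  · intro s' hF
    rw [Expr.eval_var, hF.var 0 rfl]
    simpa using (hF₁.var 0 rfl).trans hR.fwd.nodes
  · simp
  · rintro k T s' hk hv hF ⟨hT, hI⟩
    have h3 : s'.arr 7 k = G.capDist B a ⟨k, hk⟩ := by rw [hF.arr 7 rfl]; exact h7 ⟨k, hk⟩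
    have h4 : (Finset.univ.filter fun v : Fin n => (v : ℕ) < k + 1) =
        insert ⟨k, hk⟩ (Finset.univ.filter fun v : Fin n => (v : ℕ) < k) := by
      ext v
      simp only [Finset.mem_filter, Finset.mem_univ, true_and, Finset.mem_insert, Fin.ext_iff]
      omega
    simp only [h4, Finset.sup_insert, ← hI]
    simp [hv, h3, Expr.eval_lt_eq_zero hw, -Expr.eval_lt]
    exact ⟨fun h => ⟨by omega, by omega⟩, fun h => ⟨by omega, by omega⟩⟩
  · rintro T s' - ⟨hT, hI⟩
    refine ⟨by simp; omega, ?_⟩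
    rw [hI, WDigraph.capEcc]
    congr 1
    ext v
    simp
  rintro t₂ s₂ ⟨ht₂, h21⟩ hF₂
  have h18 : s₂.var 18 = s.var 18 := by rw [hF₂.var 18 rfl]; simp [hF₁.var 18 rfl]
  simp [h21, h18, Expr.eval_lt_eq_zero hw, -Expr.eval_lt]
  exact ⟨fun h => ⟨by nlinarith, h.le⟩, fun h => ⟨by nlinarith, h⟩⟩

/-- Draw a random node and record the distances to it and from it. -/
def sampleRound : Cmd :=
  .rand 4 ;;
  .assign 4 (.var 4 % .var 0) ;;
  distFrom ;;
  accumMax 10 (.var 3 - .get 7 (.var 16)) ;;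
  distTo ;;
  accumMax 9 (.get 7 (.var 16))

/-- The smallest distance from the samples is kept in the complemented form `B - d`. Then both
arrays accumulate maxima starting from `0`, and a least entry of array `10` marks a node far from
all samples. -/
theorem run_sampleRound {G : WDigraph n m} {B W l : ℕ} {s : State} (hf : Fits G w B W l)
    (hR : Ready G B s) {a : Fin n} (ha : (ω s.used : ℕ) % n = a) :
    Run w ω sampleRound s (fun t s' =>
      t ≤ (n + m + 1) * (168 * l + 500) ∧ s'.used = s.used + 1 ∧
      (∀ v : Fin n, s'.arr 9 v = max (s.arr 9 v) (G.capDist B v a)) ∧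
      (∀ v : Fin n, s'.arr 10 v = max (s.arr 10 v) (B - G.capDist B a v))) := by
  have hw : 1 < 2 ^ w := by have := hf.cap; omega
  have hn := hf.nodes
  have hB := hf.cap
  have han := a.2
  simp only [sampleRound, run_seq, run_rand, run_assign]
  have ev : (Expr.var 4 % Expr.var 0).eval w
      { s.setVar 4 (ω s.used : ℕ) with used := s.used + 1 } = a := by
    simp [hR.fwd.nodes, ha, State.setVar]
    exact Nat.mod_eq_of_lt (by omega)
  rw [ev]
  set s₀ : State := ({ s.setVar 4 (ω s.used : ℕ) with used := s.used + 1 } : State).setVar 4 a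
    with hs₀
  have e3 : s₀.arr = s.arr := rfl
  have e1 : s₀.var 0 = s.var 0 := by simp [hs₀, State.setVar]
  have e2 : s₀.var 3 = s.var 3 := by simp [hs₀, State.setVar]
  have e4 : s₀.var 4 = a := by simp [hs₀, State.setVar]
  have e5 : s₀.used = s.used + 1 := rfl
  clear_value s₀
  have hR₀ : Ready G B s₀ := ⟨
    hR.fwd.congr e1 e2 (by rw [e3]) (by rw [e3]) (by rw [e3]) (by rw [e3]),
    hR.bwd.congr e1 e2 (by rw [e3]) (by rw [e3]) (by rw [e3]) (by rw [e3])⟩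
  refine (run_distFrom hf hR₀ e4).conseq ?_
  rintro t₁ s₁ ⟨ht₁, h7⟩ hF₁
  have hR₁ := hR₀.frame hF₁ rfl
  refine (run_accumMax (f := fun v => B - G.capDist B a v) hn hR₁.fwd.nodes ?_).conseq ?_
  · intro v s' hv hF
    simp only [Expr.eval_sub, Expr.eval_var, Expr.eval_get, hv, hF.var 3 rfl, hF.arr 7 rfl,
      hR₁.fwd.cap, h7]
    exact Nat.mod_eq_of_lt (by omega)
  rintro t₂ s₂ ⟨ht₂, h10⟩ hF₂
  have hR₂ := hR₁.frame hF₂ rfl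
  refine (run_distTo hf hR₂
    (show s₂.var 4 = a by rw [hF₂.var 4 rfl, hF₁.var 4 rfl, e4])).conseq ?_
  rintro t₃ s₃ ⟨ht₃, h7'⟩ hF₃
  have hR₃ := hR₂.frame hF₃ rfl
  refine (run_accumMax (f := fun v => G.capDist B v a) hn hR₃.fwd.nodes ?_).conseq ?_
  · intro v s' hv hF
    simp only [Expr.eval_var, Expr.eval_get, hv, hF.arr 7 rfl, h7']
  rintro t₄ s₄ ⟨ht₄, h9⟩ hF₄
  simp only [Expr.cost_sub, Expr.cost_var, Expr.cost_get] at ht₂ ht₄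
  refine ⟨?_, ?_, fun v => ?_, fun v => ?_⟩
  · simp only [Expr.cost_mod, Expr.cost_var]
    nlinarith
  · rw [hF₄.used rfl, hF₃.used rfl, hF₂.used rfl, hF₁.used rfl, e5]
  · rw [h9, hF₃.arr 9 rfl, hF₂.arr 9 rfl, hF₁.arr 9 rfl, e3]
  · rw [hF₄.arr 10 rfl, hF₃.arr 10 rfl, h10, hF₁.arr 10 rfl, e3]

/-- Test the least node of the array `11` that has not been tested yet. -/
def candidateRound : Cmd :=
  argmin 11 ;;
  .assign 4 (.var 17) ;;
  .store 11 (.var 4) (.var 3 + 1) ;;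
  testNode

/-- Tested nodes are overwritten with `B + 1`, so repeated minimum search lists the nodes by
distance to `z` without sorting. Each linear scan is cheaper than the shortest path run that follows
it. -/
theorem run_candidateRound {G : WDigraph n m} {B W l : ℕ} {s : State} (hn0 : 0 < n)
    (hf : Fits G w B W l) (hR : Ready G B s) {A : Fin n → ℕ} {Y : Finset (Fin n)}
    (hA : ∀ v, A v ≤ B) (h11 : ∀ v : Fin n, s.arr 11 v = if v ∈ Y then B + 1 else A v)
    (hY : Y.card < n) :
    Run w ω candidateRound s (fun t s' =>
      t ≤ (n + m + 1) * (84 * l + 400) ∧ ∃ y ∉ Y, (∀ v ∉ Y, A y ≤ A v) ∧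
        (∀ v : Fin n, s'.arr 11 v = if v ∈ insert y Y then B + 1 else A v) ∧
        s'.var 18 = min (s.var 18) (G.capEcc B y)) := by
  have hw : 1 < 2 ^ w := by have := hf.cap; omega
  have hB := hf.cap
  simp only [candidateRound, run_seq]
  refine (run_argmin hn0 hf.nodes hR.fwd.nodes).conseq ?_
  rintro t₁ s₁ ⟨ht₁, y, h17, hmin⟩ hF₁
  have hR₁ := hR.frame hF₁ rfl
  have hmin' : ∀ v ∉ Y, y ∉ Y ∧ A y ≤ A v := by
    intro v hv
    have h1 := hmin v
    rw [h11, h11, if_neg hv] at h1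
    have := hA v
    split_ifs at h1 with h2
    · omega
    · exact ⟨h2, h1⟩
  obtain ⟨v₀, hv₀⟩ : ∃ v, v ∉ Y := by
    by_contra! hc
    have : Y = Finset.univ := Finset.eq_univ_iff_forall.2 hc
    rw [this, Finset.card_univ, Fintype.card_fin] at hY
    omega
  have hyY := (hmin' v₀ hv₀).1
  simp only [run_assign, run_store]
  refine (run_testNode (a := y) hf (s := (s₁.setVar 4 _).setArr 11 _ _) ?_ ?_).conseq ?_
  · exact ⟨hR₁.fwd.congr (by simp) (by simp) (by simp) (by simp) (by simp) (by simp),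
      hR₁.bwd.congr (by simp) (by simp) (by simp) (by simp) (by simp) (by simp)⟩
  · simp [h17]
  rintro t₂ s₂ ⟨ht₂, h18⟩ hF₂
  refine ⟨?_, y, hyY, fun v hv => (hmin' v hv).2, fun v => ?_, ?_⟩
  · simp only [Expr.cost_add, Expr.cost_var, Expr.cost_one]
    nlinarith
  · rw [hF₂.arr 11 rfl]
    simp (disch := omega) [h17, hR₁.fwd.cap, Nat.mod_eq_of_lt, Function.update_apply, Fin.val_inj,
      hF₁.arr 11 rfl, h11]
    by_cases h : v = y <;> simp [h]
  · rw [h18]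
    simp [hF₁.var 18 rfl]

end WordRAM

namespace WordRAM

variable {w : ℕ} {ω : ℕ → Fin (2 ^ w)} {n m : ℕ}

/-! ## The radius algorithm -/

/-- Read the graph and compute the parameters of the algorithm; `K` controls the number of
samples. -/
def prepare (K : ℕ) : Cmd :=
  maxWeight ;;
  .assign 3 (.var 0 * .var 2 + 1) ;;
  buildLists 0 3 4 ;;
  buildLists 1 5 6 ;;
  ceilSqrt ;;
  ceilLog ;;
  .assign 15 (.lit K * .var 12 * .var 13)

/-- Test a node that is close to all samples. -/
def testCentral : Cmd :=
  argmin 9 ;;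
  .assign 4 (.var 17) ;;
  .assign 18 (.var 3) ;;
  testNode

/-- Find a node that is far from all samples and compute the distances to it. -/
def findRemote : Cmd :=
  argmin 10 ;;
  .assign 4 (.var 17) ;;
  distTo ;;
  .forUpTo 16 (.var 0) (.store 11 (.var 16) (.get 7 (.var 16)))

/-- The approximation algorithm for the source radius. -/
def radius (K : ℕ) : Cmd :=
  -- With fewer than `n - 1` edges the radius is infinite. Past this test `n ≤ m + 1`, so times
  -- linear in `n` are linear in `m`.
  .branch (.op .lt (.var 1 + 1) (.var 0)) (.assign 1 1)
    (prepare K ;;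
      .forUpTo 19 (.var 15) sampleRound ;;
      testCentral ;;
      findRemote ;;
      .forUpTo 20 (.var 12) candidateRound ;;
      -- The value of the cap means that no tested node reaches everything. Variable `1` still holds
      -- `m`, so a finite answer has to clear it.
      .branch (.op .eq (.var 18) (.var 3)) (.assign 1 1) (.assign 1 0 ;; .assign 0 (.var 18)))

/-! ### Parameters and word size -/

/-- The cap on distances that the algorithm uses. -/
def cap (G : WDigraph n m) : ℕ := n * Finset.univ.sup G.wt + 1

/-- The number of candidates that the algorithm tests. -/
def rootCeil (n : ℕ) : ℕ := (n - 1).sqrt + 1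

theorem fits_of_lt {G : WDigraph n m} {M K : ℕ} (hn : 2 ≤ n) (hm : 1 ≤ m) (hM : ∀ e, G.wt e ≤ M)
    (hw : (K + 1) * (n + m + M) ^ 3 < 2 ^ w) :
    Fits G w (cap G) (Finset.univ.sup G.wt) (Nat.clog 2 n) := by
  have hs : Finset.univ.sup G.wt ≤ M := Finset.sup_le fun e _ => hM e
  have hN : 3 ≤ n + m + M := by omega
  have hN2 : (n + m + M) ^ 2 * 3 ≤ (n + m + M) ^ 3 := by
    rw [pow_succ (n + m + M) 2]; exact Nat.mul_le_mul_left _ hN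
  have hN3 : (n + m + M) ^ 3 < 2 ^ w := lt_of_le_of_lt (by nlinarith) hw
  have h1 : n * Finset.univ.sup G.wt ≤ n * M := Nat.mul_le_mul_left _ hs
  refine ⟨fun e => Finset.le_sup (Finset.mem_univ e), ?_, ?_, ?_, Nat.le_pow_clog (by omega) n⟩
  · rw [cap]
    nlinarith
  · nlinarith
  · nlinarith

theorem rootCeil_le (hn : 2 ≤ n) : rootCeil n ≤ n := by
  have := Nat.sqrt_le_self (n - 1)
  rw [rootCeil]
  omega

theorem le_rootCeil_mul_self (n : ℕ) : n ≤ rootCeil n * rootCeil n := by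
  have := Nat.lt_succ_sqrt (n - 1)
  rw [Nat.succ_eq_add_one] at this
  rw [rootCeil]
  omega

/-- Both `rootCeil n` and `Nat.clog 2 n` are at most `n`, so the number of samples is at most `K * n
^ 2`. -/
theorem samples_lt {M K : ℕ} (hn : 2 ≤ n) (hm : 1 ≤ m)
    (hw : (K + 1) * (n + m + M) ^ 3 < 2 ^ w) :
    n * n < 2 ^ w ∧ K < 2 ^ w ∧ K * rootCeil n < 2 ^ w ∧
      K * rootCeil n * Nat.clog 2 n < 2 ^ w := by
  have h1 : n * n ≤ (n + m + M) ^ 3 := by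
    calc n * n = n ^ 2 := by ring
      _ ≤ (n + m + M) ^ 2 := Nat.pow_le_pow_left (by omega) 2
      _ ≤ (n + m + M) ^ 3 := Nat.pow_le_pow_right (by omega) (by omega)
  have h2 : (K + 1) * (n * n) ≤ (K + 1) * (n + m + M) ^ 3 := Nat.mul_le_mul_left _ h1
  have h3 : 1 ≤ n * n := Nat.mul_pos (by omega) (by omega)
  have h4 : K * 1 ≤ K * (n * n) := Nat.mul_le_mul_left _ h3
  have hq := rootCeil_le hn
  have hL : Nat.clog 2 n ≤ n := Nat.clog_le_of_le_pow Nat.lt_two_pow_self.le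
  have b1 : K * rootCeil n ≤ K * n := Nat.mul_le_mul_left _ hq
  have b2 : K * rootCeil n * Nat.clog 2 n ≤ K * n * n := Nat.mul_le_mul b1 hL
  have b3 : K * n ≤ K * (n * n) := Nat.mul_le_mul_left _ (by nlinarith)
  have b4 : K * n * n = K * (n * n) := by ring
  refine ⟨?_, ?_, ?_, ?_⟩ <;> nlinarith

theorem run_prepare {G : WDigraph n m} {M K : ℕ} (hn : 2 ≤ n) (hm : 1 ≤ m)
    (hM : ∀ e, G.wt e ≤ M) (hw : (K + 1) * (n + m + M) ^ 3 < 2 ^ w) :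
    Run w ω (prepare K) (input G) (fun t s' => t ≤ 61 * m + 50 * n + 100 ∧ Ready G (cap G) s' ∧
      s'.var 12 = rootCeil n ∧ s'.var 15 = K * rootCeil n * Nat.clog 2 n) := by
  have hf := fits_of_lt (K := K) hn hm hM hw
  have hw1 : 1 < 2 ^ w := by have := hf.nodes; omega
  have hcap := hf.cap
  obtain ⟨hnn, hK, hKq, hKqL⟩ := samples_lt (K := K) hn hm hw
  simp only [prepare, run_seq]
  refine (run_maxWeight (G := G) (M := Finset.univ.sup G.wt) hf.weight hf.edges (by simp [input])
    (by simp [input])).conseq ?_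
  rintro t₁ s₁ ⟨ht₁, h2, h2'⟩ hF₁
  have hW : s₁.var 2 = Finset.univ.sup G.wt := le_antisymm h2' (Finset.sup_le fun e _ => h2 e)
  have v0 : s₁.var 0 = n := by rw [hF₁.var 0 rfl]; simp [input]
  have v1 : s₁.var 1 = m := by rw [hF₁.var 1 rfl]; simp [input]
  have ev : (Expr.var 0 * Expr.var 2 + 1).eval w s₁ = cap G := by
    rw [cap] at hcap ⊢
    simp (disch := omega) [v0, hW, Nat.mod_eq_of_lt]
  simp only [run_assign, ev]
  refine (run_buildLists (G := G) hf.edges (by simpa using v1) ?_ ?_ (by decide) (by decide)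
    (by decide)).conseq ?_
  · intro e
    rw [State.arr_setVar, hF₁.arr 0 rfl]
    simp [input]
  · intro u
    rw [State.arr_setVar, hF₁.arr 3 rfl]
    simp [input]
  rintro t₂ s₂ ⟨ht₂, hhd, hnx⟩ hF₂
  refine (run_buildLists (G := G.reverse) hf.edges (by rw [hF₂.var 1 rfl]; simpa using v1) ?_ ?_
    (by decide) (by decide) (by decide)).conseq ?_
  · intro e
    rw [hF₂.arr 1 rfl, State.arr_setVar, hF₁.arr 1 rfl]
    simp [input, WDigraph.reverse]
  · intro u
    rw [hF₂.arr 5 rfl, State.arr_setVar, hF₁.arr 5 rfl]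
    simp [input]
  rintro t₃ s₃ ⟨ht₃, hhd', hnx'⟩ hF₃
  have v0' : s₃.var 0 = n := by rw [hF₃.var 0 rfl, hF₂.var 0 rfl]; simpa using v0
  have v3 : s₃.var 3 = cap G := by rw [hF₃.var 3 rfl, hF₂.var 3 rfl]; simp
  have hR : Ready G (cap G) s₃ := by
    refine ⟨⟨v0', v3, fun e => ?_, fun e => ?_, fun u => ?_, fun e => ?_⟩,
      ⟨v0', v3, fun e => ?_, fun e => ?_, hhd', hnx'⟩⟩
    · rw [hF₃.arr 1 rfl, hF₂.arr 1 rfl, State.arr_setVar, hF₁.arr 1 rfl]; simp [input]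
    · rw [hF₃.arr 2 rfl, hF₂.arr 2 rfl, State.arr_setVar, hF₁.arr 2 rfl]; simp [input]
    · rw [hF₃.arr 3 rfl, hhd]
    · rw [hF₃.arr 4 rfl, hnx]
    · rw [hF₃.arr 0 rfl, hF₂.arr 0 rfl, State.arr_setVar, hF₁.arr 0 rfl]
      simp [input, WDigraph.reverse]
    · rw [hF₃.arr 2 rfl, hF₂.arr 2 rfl, State.arr_setVar, hF₁.arr 2 rfl]
      simp [input, WDigraph.reverse]
  refine (run_ceilSqrt hn hnn v0').conseq ?_
  rintro t₄ s₄ ⟨ht₄, h12⟩ hF₄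
  have hR₄ := hR.frame hF₄ rfl
  refine (run_ceilLog hn hf.nodes hR₄.fwd.nodes).conseq ?_
  rintro t₅ s₅ ⟨ht₅, h13⟩ hF₅
  have hR₅ := hR₄.frame hF₅ rfl
  have h12' : s₅.var 12 = rootCeil n := (hF₅.var 12 rfl).trans h12
  have ev' : (Expr.lit K * Expr.var 12 * Expr.var 13).eval w s₅ =
      K * rootCeil n * Nat.clog 2 n := by
    simp only [Expr.eval_mul, Expr.eval_lit, Expr.eval_var, h12', h13]
    rw [Nat.mod_eq_of_lt hK, Nat.mod_eq_of_lt hKq, Nat.mod_eq_of_lt hKqL]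
  rw [ev']
  refine ⟨?_, ⟨hR₅.fwd.congr (by simp) (by simp) (by simp) (by simp) (by simp) (by simp),
    hR₅.bwd.congr (by simp) (by simp) (by simp) (by simp) (by simp) (by simp)⟩, ?_, ?_⟩
  · simp only [Expr.cost_add, Expr.cost_mul, Expr.cost_var, Expr.cost_lit, Expr.cost_one]
    omega
  · simpa using h12'
  · simp

theorem run_testCentral {G : WDigraph n m} {B W l : ℕ} {s : State} (hn0 : 0 < n)
    (hf : Fits G w B W l) (hR : Ready G B s) :
    Run w ω testCentral s (fun t s' => t ≤ (n + m + 1) * (84 * l + 400) ∧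
      ∃ x : Fin n, (∀ v : Fin n, s.arr 9 x ≤ s.arr 9 v) ∧ s'.var 18 = min B (G.capEcc B x)) := by
  simp only [testCentral, run_seq]
  refine (run_argmin hn0 hf.nodes hR.fwd.nodes).conseq ?_
  rintro t₁ s₁ ⟨ht₁, x, h17, hmin⟩ hF₁
  have hR₁ := hR.frame hF₁ rfl
  simp only [run_assign]
  refine (run_testNode (a := x) hf (s := (s₁.setVar 4 _).setVar 18 _) ?_ ?_).conseq ?_
  · exact ⟨hR₁.fwd.congr (by simp) (by simp) (by simp) (by simp) (by simp) (by simp),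
      hR₁.bwd.congr (by simp) (by simp) (by simp) (by simp) (by simp) (by simp)⟩
  · simp [h17]
  rintro t₂ s₂ ⟨ht₂, h18⟩ hF₂
  refine ⟨?_, x, hmin, ?_⟩
  · simp only [Expr.cost_var]
    nlinarith
  · rw [h18]
    simp [hR₁.fwd.cap]

theorem run_findRemote {G : WDigraph n m} {B W l : ℕ} {s : State} (hn0 : 0 < n)
    (hf : Fits G w B W l) (hR : Ready G B s) :
    Run w ω findRemote s (fun t s' => t ≤ (n + m + 1) * (84 * l + 400) ∧
      ∃ z : Fin n, (∀ v : Fin n, s.arr 10 z ≤ s.arr 10 v) ∧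
        ∀ v : Fin n, s'.arr 11 v = G.capDist B v z) := by
  have hw : 1 < 2 ^ w := by have := hf.nodes; omega
  have hn := hf.nodes
  simp only [findRemote, run_seq]
  refine (run_argmin hn0 hf.nodes hR.fwd.nodes).conseq ?_
  rintro t₁ s₁ ⟨ht₁, z, h17, hmin⟩ hF₁
  have hR₁ := hR.frame hF₁ rfl
  simp only [run_assign]
  refine (run_distTo (a := z) hf (s := s₁.setVar 4 _) ?_ ?_).conseq ?_
  · exact ⟨hR₁.fwd.congr (by simp) (by simp) (by simp) (by simp) (by simp) (by simp),
      hR₁.bwd.congr (by simp) (by simp) (by simp) (by simp) (by simp) (by simp)⟩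
  · simp [h17]
  rintro t₂ s₂ ⟨ht₂, h7⟩ hF₂
  have v0 : s₂.var 0 = n := by rw [hF₂.var 0 rfl]; simpa using hR₁.fwd.nodes
  refine Run.forUpTo n hw (by omega) rfl
    (fun k T s' => T ≤ 12 * k + 2 ∧ ∀ v : Fin n, (v : ℕ) < k → s'.arr 11 v = G.capDist B v z)
    ?_ (by simp) ?_ ?_
  · intro s' hF
    rw [Expr.eval_var, hF.var 0 rfl, v0]
  · rintro k T s' hk hv hF ⟨hT, hI⟩
    have h3 : s'.arr 7 k = G.capDist B ⟨k, hk⟩ z := by rw [hF.arr 7 rfl]; exact h7 ⟨k, hk⟩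
    simp [hv, h3]
    refine ⟨by omega, fun v hv' => ?_⟩
    by_cases hvk : (v : ℕ) = k
    · obtain rfl : v = ⟨k, hk⟩ := Fin.ext hvk
      simp
    · rw [Function.update_of_ne hvk]
      exact hI v (by omega)
  · rintro T s' - ⟨hT, hI⟩
    refine ⟨?_, z, hmin, fun v => hI v v.2⟩
    simp only [Expr.cost_var]
    nlinarith

/-- The node sampled with a random word. -/
def sampleNode (hn : 0 < n) (x : Fin (2 ^ w)) : Fin n := ⟨x % n, Nat.mod_lt _ hn⟩

/-- The first `k` samples hit all sets of at least `q` nodes that consist of the nodes closest to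
some node. -/
def HitsBalls (G : WDigraph n m) (hn : 0 < n) (B q k : ℕ) (ω : ℕ → Fin (2 ^ w)) : Prop :=
  ∀ x v, q ≤ (Finset.univ.filter fun y => G.capDist B y v ≤ G.capDist B x v).card →
    ∃ i < k, G.capDist B (sampleNode hn (ω i)) v ≤ G.capDist B x v

theorem run_sampling {G : WDigraph n m} {B W l k : ℕ} {s : State} (hn0 : 0 < n)
    (hf : Fits G w B W l) (hR : Ready G B s) (hk : s.var 15 = k) (hkw : k < 2 ^ w)
    (hu : s.used = 0) (h9 : ∀ v : Fin n, s.arr 9 v = 0) (h10 : ∀ v : Fin n, s.arr 10 v = 0) :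
    Run w ω (.forUpTo 19 (.var 15) sampleRound) s (fun t s' =>
      t ≤ k * ((n + m + 1) * (168 * l + 600)) + 6 ∧
      (∀ v : Fin n, s'.arr 9 v = ((Finset.range k).image fun i => sampleNode hn0 (ω i)).sup
        fun a => G.capDist B v a) ∧
      (∀ v : Fin n, s'.arr 10 v = ((Finset.range k).image fun i => sampleNode hn0 (ω i)).sup
        fun a => B - G.capDist B a v)) := by
  have hw : 1 < 2 ^ w := by have := hf.nodes; omega
  -- The counter `used` in the invariant ensures that round `i` draws exactly the word `ω i`.
  refine Run.forUpTo k hw hkw rfl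
    (fun k T s' => T ≤ k * ((n + m + 1) * (168 * l + 600)) + 2 ∧ s'.used = k ∧
      (∀ v : Fin n, s'.arr 9 v = ((Finset.range k).image fun i => sampleNode hn0 (ω i)).sup
        fun a => G.capDist B v a) ∧
      (∀ v : Fin n, s'.arr 10 v = ((Finset.range k).image fun i => sampleNode hn0 (ω i)).sup
        fun a => B - G.capDist B a v)) ?_ ?_ ?_ ?_
  · intro s' hF
    rw [Expr.eval_var, hF.var 15 rfl, hk]
  · simp [hu, h9, h10]
  · rintro j T s' hj hv hF ⟨hT, hu', h9', h10'⟩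
    refine (run_sampleRound (a := sampleNode hn0 (ω j)) hf (hR.frame hF rfl)
      (by rw [hu']; rfl)).mono ?_
    rintro t s'' ⟨ht, hu'', h9'', h10''⟩
    refine ⟨?_, by simp [hu'', hu'], fun v => ?_, fun v => ?_⟩
    · rw [Expr.cost_var, Nat.succ_mul]
      nlinarith
    · rw [State.arr_setVar, h9'', h9', Finset.range_add_one, Finset.image_insert,
        Finset.sup_insert, max_comm]
    · rw [State.arr_setVar, h10'', h10', Finset.range_add_one, Finset.image_insert,
        Finset.sup_insert, max_comm]
  · rintro T s' hF ⟨hT, hu', h9', h10'⟩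
    exact ⟨by simp; omega, h9', h10'⟩

theorem run_candidates {G : WDigraph n m} {B W l q : ℕ} {s : State} {z : Fin n} (hn0 : 0 < n)
    (hf : Fits G w B W l) (hR : Ready G B s) (hq : s.var 12 = q) (hqn : q ≤ n)
    (h11 : ∀ v : Fin n, s.arr 11 v = G.capDist B v z) :
    Run w ω (.forUpTo 20 (.var 12) candidateRound) s (fun t s' =>
      t ≤ q * ((n + m + 1) * (84 * l + 500)) + 6 ∧
      ∃ Y : Finset (Fin n), Y.card = q ∧
        (∀ y ∈ Y, ∀ x ∉ Y, G.capDist B y z ≤ G.capDist B x z) ∧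
        s'.var 18 ≤ s.var 18 ∧ (∀ y ∈ Y, s'.var 18 ≤ G.capEcc B y) ∧
        (s'.var 18 = s.var 18 ∨ ∃ x, s'.var 18 = G.capEcc B x)) := by
  have hn := hf.nodes
  have hw : 1 < 2 ^ w := by omega
  refine Run.forUpTo q hw (by omega) rfl
    (fun k T s' => T ≤ k * ((n + m + 1) * (84 * l + 500)) + 2 ∧
      ∃ Y : Finset (Fin n), Y.card = k ∧
        (∀ v : Fin n, s'.arr 11 v = if v ∈ Y then B + 1 else G.capDist B v z) ∧
        (∀ y ∈ Y, ∀ x ∉ Y, G.capDist B y z ≤ G.capDist B x z) ∧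
        s'.var 18 ≤ s.var 18 ∧ (∀ y ∈ Y, s'.var 18 ≤ G.capEcc B y) ∧
        (s'.var 18 = s.var 18 ∨ ∃ x, s'.var 18 = G.capEcc B x)) ?_ ?_ ?_ ?_
  · intro s' hF
    rw [Expr.eval_var, hF.var 12 rfl, hq]
  · exact ⟨by omega, ∅, by simp [h11]⟩
  · rintro k T s' hk hv hF ⟨hT, Y, hY, h11', hord, hle, hecc, hor⟩
    refine (run_candidateRound hn0 hf (hR.frame hF rfl) (fun v => G.capDist_le B v z) h11'
      (by omega)).mono ?_
    rintro t s'' ⟨ht, y, hy, hmin, h11'', h18⟩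
    refine ⟨?_, insert y Y, by rw [Finset.card_insert_of_notMem hy, hY], ?_, ?_, ?_, ?_, ?_⟩
    · rw [Expr.cost_var, Nat.succ_mul]
      nlinarith
    · simpa using h11''
    · intro y' hy' x hx
      rw [Finset.mem_insert, not_or] at hx
      rcases Finset.mem_insert.1 hy' with rfl | hy'
      · exact hmin x hx.2
      · exact hord y' hy' x hx.2
    · simp only [State.var_setVar]
      simp [h18, hle]
    · intro y' hy'
      simp only [State.var_setVar]
      rw [if_neg (by decide), h18]
      rcases Finset.mem_insert.1 hy' with rfl | hy'
      · exact min_le_right _ _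
      · exact (min_le_left _ _).trans (hecc y' hy')
    · simp only [State.var_setVar]
      rw [if_neg (by decide), h18]
      rcases min_choice (s'.var 18) (G.capEcc B y) with h | h <;> rw [h]
      · exact hor
      · exact .inr ⟨y, rfl⟩
  · rintro T s' hF ⟨hT, Y, hY, h11', hord, hle, hecc, hor⟩
    exact ⟨by simp; omega, Y, hY, hord, hle, hecc, hor⟩

/-- From `n ≤ m + 1` follows `n + m + 1 ≤ 4 * m`. The leading term comes from `K * q * L` sampling
rounds of cost `O(m * L)`. -/
theorem radius_time_le {K m n q L : ℕ} (hm : 1 ≤ m) (hnm : n ≤ m + 1) (hq : 1 ≤ q) (hL : 1 ≤ L) :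
    61 * m + 50 * n + 100 + (K * q * L * ((n + m + 1) * (168 * L + 600)) + 6) +
      2 * ((n + m + 1) * (84 * L + 400)) + (q * ((n + m + 1) * (84 * L + 500)) + 6) + 40 ≤
      7000 * (K + 1) * (m * q * L * L) := by
  have hA : n + m + 1 ≤ 4 * m := by omega
  have h1 : (n + m + 1) * (168 * L + 600) ≤ 4 * m * (768 * L) := Nat.mul_le_mul hA (by omega)
  have h2 : (n + m + 1) * (84 * L + 400) ≤ 4 * m * (484 * L) := Nat.mul_le_mul hA (by omega)
  have h3 : (n + m + 1) * (84 * L + 500) ≤ 4 * m * (584 * L) := Nat.mul_le_mul hA (by omega)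
  have h4 := Nat.mul_le_mul_left (K * q * L) h1
  have h5 := Nat.mul_le_mul_left q h3
  have e4 : K * q * L * (4 * m * (768 * L)) = 3072 * (K * (m * q * L * L)) := by ring
  have e5 : q * (4 * m * (584 * L)) = 2336 * (m * q * L) := by ring
  have e2 : 4 * m * (484 * L) = 1936 * (m * L) := by ring
  have e6 : 7000 * (K + 1) * (m * q * L * L) =
      7000 * (K * (m * q * L * L)) + 7000 * (m * q * L * L) := by ring
  have g1 : m * q * L ≤ m * q * L * L := Nat.le_mul_of_pos_right _ hL
  have g2 : m * L ≤ m * q * L := Nat.mul_le_mul_right _ (Nat.le_mul_of_pos_right _ hq)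
  have g3 : m ≤ m * L := Nat.le_mul_of_pos_right _ hL
  omega

theorem run_radius {G : WDigraph n m} {M K : ℕ} (hn : 2 ≤ n) (hm : 1 ≤ m)
    (hM : ∀ e, G.wt e ≤ M) (hw : (K + 1) * (n + m + M) ^ 3 < 2 ^ w) :
    Run w ω (radius K) (input G) (fun t s' =>
      t ≤ 7000 * (K + 1) * (m * rootCeil n * Nat.clog 2 n * Nat.clog 2 n) ∧
      (HitsBalls G (by omega) (cap G) (rootCeil n) (K * rootCeil n * Nat.clog 2 n) ω →
        G.sourceRadius ≤ s'.output ∧ s'.output ≤ 2 * G.sourceRadius)) := by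
  have hf := fits_of_lt (K := K) hn hm hM hw
  have hn0 : 0 < n := by omega
  have hw1 : 1 < 2 ^ w := by have := hf.nodes; omega
  have hL : 1 ≤ Nat.clog 2 n := Nat.clog_pos (by omega) hn
  have hq : 1 ≤ rootCeil n := by rw [rootCeil]; omega
  have he := hf.edges
  rw [radius, run_branch]
  simp (disch := omega) only [Ne, Expr.eval_lt_eq_zero hw1, Expr.eval_add, Expr.eval_var,
    Expr.eval_one, Nat.mod_eq_of_lt, show (input G).var 0 = n from rfl,
    show (input G).var 1 = m from rfl, not_le, Expr.cost_op, Expr.cost_add, Expr.cost_var,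
    Expr.cost_one]
  constructor
  · intro hlt
    rw [run_assign]
    constructor
    · have : 1 ≤ m * rootCeil n * Nat.clog 2 n * Nat.clog 2 n :=
        Nat.mul_pos (Nat.mul_pos (Nat.mul_pos hm hq) hL) hL
      have := Nat.mul_le_mul (show 7000 ≤ 7000 * (K + 1) by omega) this
      rw [Expr.cost_one]
      omega
    · intro _
      rw [G.sourceRadius_eq_top hn0 hlt]
      simp [State.output, Nat.mod_eq_of_lt hw1]
  · intro hnm
    have htime := radius_time_le (K := K) hm hnm hq hL
    simp only [run_seq]
    refine (run_prepare hn hm hM hw).conseq ?_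
    rintro t₁ s₁ ⟨ht₁, hR₁, h12, h15⟩ hF₁
    refine (run_sampling hn0 hf hR₁ h15 (samples_lt hn hm hw).2.2.2 ?_ ?_ ?_).conseq ?_
    · rw [hF₁.used rfl]; rfl
    · intro v; rw [hF₁.arr 9 rfl]; simp [input]
    · intro v; rw [hF₁.arr 10 rfl]; simp [input]
    rintro t₂ s₂ ⟨ht₂, h9, h10⟩ hF₂
    have hR₂ := hR₁.frame hF₂ rfl
    refine (run_testCentral hn0 hf hR₂).conseq ?_
    rintro t₃ s₃ ⟨ht₃, x₁, hx₁, h18⟩ hF₃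
    have hR₃ := hR₂.frame hF₃ rfl
    refine (run_findRemote hn0 hf hR₃).conseq ?_
    rintro t₄ s₄ ⟨ht₄, z, hz, h11⟩ hF₄
    have hR₄ := hR₃.frame hF₄ rfl
    have h12' : s₄.var 12 = rootCeil n := by
      rw [hF₄.var 12 rfl, hF₃.var 12 rfl, hF₂.var 12 rfl, h12]
    refine (run_candidates hn0 hf hR₄ h12' (rootCeil_le hn) h11).conseq ?_
    rintro t₅ s₅ ⟨ht₅, Y, hY, hord, hle, hecc, hor⟩ hF₅
    have hR₅ := hR₄.frame hF₅ rfl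
    rw [hF₄.var 18 rfl, h18] at hle hor
    -- Arrays `9` and `10` hold suprema over the sample set, so minimality of their entries is what
    -- `radius_approx` asks of `x₁` and `z`.
    simp only [h9] at hx₁
    simp only [hF₃.arr 10 rfl, h10] at hz
    have key : HitsBalls G (by omega) (cap G) (rootCeil n) (K * rootCeil n * Nat.clog 2 n) ω →
        G.sourceRadius ≤ (if s₅.var 18 = cap G then ⊤ else (s₅.var 18 : ℕ∞)) ∧
        (if s₅.var 18 = cap G then ⊤ else (s₅.var 18 : ℕ∞)) ≤ 2 * G.sourceRadius := by
      intro hH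
      refine WDigraph.radius_approx hn0 hf.weight (Nat.lt_succ_self _) hx₁ hz hord hY.ge ?_ ?_
        (hle.trans (min_le_left _ _)) (hle.trans (min_le_right _ _)) hecc
      · intro x v hc
        obtain ⟨i, hi, hi'⟩ := hH x v hc
        exact ⟨_, Finset.mem_image_of_mem _ (Finset.mem_range.2 hi), hi'⟩
      · rcases hor with hor | hor
        · rw [hor]
          rcases min_choice (cap G) (G.capEcc (cap G) x₁) with h | h <;> rw [h]
          · exact .inl rfl
          · exact .inr ⟨x₁, rfl⟩
        · exact .inr hor
    simp only [run_branch, run_assign, run_seq, Ne, Expr.eval_eq_eq_zero hw1, Expr.eval_var,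
      hR₅.fwd.cap, not_not, Expr.cost_op, Expr.cost_var, Expr.cost_one, Expr.cost_zero]
    refine ⟨fun h => ⟨by omega, ?_⟩, fun h => ⟨by omega, ?_⟩⟩
    · rw [if_pos h] at key
      simpa [State.output, Nat.mod_eq_of_lt hw1] using key
    · rw [if_neg h] at key
      simpa [State.output] using key

end WordRAM

namespace WordRAM

open MeasureTheory

variable {w n m : ℕ}

/-! ## The failure probability -/

instance (w : ℕ) : IsProbabilityMeasure (PMF.uniformOfFintype (Fin (2 ^ w))).toMeasure :=
  PMF.toMeasure.isProbabilityMeasure _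

/-- The event is a finite cylinder, and the product measure multiplies over its coordinates. -/
theorem randomWords_forall_mem (w k : ℕ) (E : Set (Fin (2 ^ w))) :
    randomWords w {ω | ∀ i < k, ω i ∈ E} =
      ((PMF.uniformOfFintype (Fin (2 ^ w))).toMeasure E) ^ k := by
  have h : {ω : ℕ → Fin (2 ^ w) | ∀ i < k, ω i ∈ E} =
      ((Finset.range k : Finset ℕ) : Set ℕ).pi fun _ => E := by
    ext ω
    simp [Set.mem_pi]
  rw [h, randomWords, Measure.infinitePi_pi _ fun _ _ => MeasurableSet.of_discrete]
  simp

/-- A random word misses a set of `q` of the `n` residues with probability at most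
`1 - q / (2 * n)`. -/
theorem uniform_miss_le {q : ℕ} (hn : 0 < n) (hw : 2 * n ≤ 2 ^ w) (A : Finset (Fin n))
    (hA : q ≤ A.card) :
    (PMF.uniformOfFintype (Fin (2 ^ w))).toMeasure {x | sampleNode hn x ∉ A} ≤
      ENNReal.ofReal (1 - q / (2 * n)) := by
  -- A random word modulo `n` is not uniform, but every residue has at least `D` preimages, and `2 *
  -- n ≤ 2 ^ w` yields `2 ^ w ≤ 2 * n * D`. This is the source of the factor `2` in the bound.
  set D := 2 ^ w / n with hD
  have hDn : n * D ≤ 2 ^ w := Nat.mul_div_le _ _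
  have hDn' : 2 ^ w ≤ 2 * (n * D) := by
    have h1 := Nat.lt_mul_div_succ (2 ^ w) hn
    have h2 : 2 ^ w < n * D + n := by rw [hD]; linarith [h1, Nat.mul_succ n (2 ^ w / n)]
    omega
  set F : Finset (Fin (2 ^ w)) := Finset.univ.filter fun x => sampleNode hn x ∉ A with hF
  have hcard : F.card + A.card * D ≤ 2 ^ w := by
    have h1 : (A ×ˢ (Finset.univ : Finset (Fin D))).card ≤
        (Finset.univ.filter fun x : Fin (2 ^ w) => sampleNode hn x ∈ A).card := by
      have hlt : ∀ p : Fin n × Fin D, (p.1 : ℕ) + n * p.2 < 2 ^ w := by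
        intro p
        have h2 : n * ((p.2 : ℕ) + 1) ≤ n * D := Nat.mul_le_mul_left _ p.2.2
        have := p.1.2
        rw [Nat.mul_add] at h2
        omega
      refine Finset.card_le_card_of_injOn (fun p => ⟨p.1 + n * p.2, hlt p⟩) ?_ ?_
      · rintro ⟨a, j⟩ hp
        simp only [Finset.coe_product, Finset.coe_univ, Set.mem_prod, Finset.mem_coe,
          Set.mem_univ, and_true] at hp
        have : sampleNode hn (⟨a + n * j, hlt (a, j)⟩ : Fin (2 ^ w)) = a := by
          apply Fin.ext
          simp [sampleNode, Nat.add_mul_mod_self_left, Nat.mod_eq_of_lt a.2]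
        simp [this, hp]
      · rintro ⟨a, j⟩ - ⟨a', j'⟩ - h
        simp only [Fin.mk.injEq] at h
        have h1 : (a : ℕ) = a' := by
          have := congrArg (· % n) h
          simpa [Nat.add_mul_mod_self_left, Nat.mod_eq_of_lt a.2, Nat.mod_eq_of_lt a'.2] using this
        have h2 : (j : ℕ) = j' := Nat.eq_of_mul_eq_mul_left hn (by omega)
        exact Prod.ext (Fin.ext h1) (Fin.ext h2)
    have h2 := Finset.card_filter_add_card_filter_not (s := (Finset.univ : Finset (Fin (2 ^ w))))
      (fun x => sampleNode hn x ∈ A)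
    have h3 : (Finset.univ.filter fun x : Fin (2 ^ w) => ¬ sampleNode hn x ∈ A).card = F.card := by
      rw [hF]
    rw [Finset.card_product, Finset.card_univ, Fintype.card_fin] at h1
    rw [Finset.card_univ, Fintype.card_fin] at h2
    simp only [h3] at h2
    omega
  have hset : {x : Fin (2 ^ w) | sampleNode hn x ∉ A} = (F : Set (Fin (2 ^ w))) := by
    ext x; simp [hF]
  rw [hset, PMF.toMeasure_uniformOfFintype_apply _ MeasurableSet.of_discrete]
  simp only [Finset.coe_sort_coe, Fintype.card_coe, Fintype.card_fin]
  have hpos : (0 : ℝ) < ((2 ^ w : ℕ) : ℝ) := by positivity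
  rw [← ENNReal.ofReal_natCast F.card, ← ENNReal.ofReal_natCast (2 ^ w),
    ← ENNReal.ofReal_div_of_pos hpos]
  apply ENNReal.ofReal_le_ofReal
  have hn' : (0 : ℝ) < n := by exact_mod_cast hn
  have h1 : (F.card : ℝ) + A.card * D ≤ (2 ^ w : ℕ) := by exact_mod_cast hcard
  have h2 : ((2 ^ w : ℕ) : ℝ) ≤ 2 * (n * D) := by exact_mod_cast hDn'
  have h3 : (q : ℝ) ≤ A.card := by exact_mod_cast hA
  rw [div_le_iff₀ hpos]
  have h4 : (q : ℝ) / (2 * n) * (2 ^ w : ℕ) ≤ A.card * D := by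
    rw [div_mul_eq_mul_div, div_le_iff₀ (by positivity)]
    have : (q : ℝ) * (2 ^ w : ℕ) ≤ A.card * (2 * (n * D)) :=
      mul_le_mul h3 h2 hpos.le (by positivity)
    linarith
  linarith

/-- By `1 - x ≤ exp (-x)` the exponent becomes `(c + 2) * L * (q * q / n)`, where `q * q / n ≥ 1`;
finally `exp L ≥ 2 ^ L ≥ n`. -/
theorem miss_pow_le {c q L : ℕ} (hn : 0 < n) (hqn : q ≤ n) (hq : n ≤ q * q) (hL : n ≤ 2 ^ L) :
    (1 - (q : ℝ) / (2 * n)) ^ (2 * (c + 2) * q * L) ≤ ((n : ℝ) ^ (c + 2))⁻¹ := by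
  have hn' : (0 : ℝ) < n := by exact_mod_cast hn
  have hq' : (n : ℝ) ≤ q * q := by exact_mod_cast hq
  have hL' : (n : ℝ) ≤ 2 ^ L := by exact_mod_cast hL
  have hqn' : (q : ℝ) ≤ n := by exact_mod_cast hqn
  have h0 : 0 ≤ 1 - (q : ℝ) / (2 * n) := by
    rw [sub_nonneg, div_le_one (by positivity)]
    linarith
  have h1 : 1 - (q : ℝ) / (2 * n) ≤ Real.exp (-(q / (2 * n))) := by
    have := Real.add_one_le_exp (-((q : ℝ) / (2 * n)))
    linarith
  have h2 : Real.exp (-(q / (2 * n))) ^ (2 * (c + 2) * q * L) ≤ Real.exp (-((c + 2) * L)) := by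
    rw [← Real.exp_nat_mul]
    apply Real.exp_le_exp.2
    have e : ((2 * (c + 2) * q * L : ℕ) : ℝ) * -(q / (2 * n)) =
        -(((c + 2) * L) * (q * q / n)) := by
      push_cast
      field_simp
    rw [e, neg_le_neg_iff]
    have : (1 : ℝ) ≤ q * q / n := by rwa [le_div_iff₀ hn', one_mul]
    exact le_mul_of_one_le_right (by positivity) this
  have h3 : Real.exp (-((c + 2) * L)) = ((Real.exp 1 ^ L) ^ (c + 2))⁻¹ := by
    rw [Real.exp_neg, ← Real.exp_nat_mul, ← Real.exp_nat_mul]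
    push_cast
    ring_nf
  have h4 : (n : ℝ) ≤ Real.exp 1 ^ L := by
    refine hL'.trans (pow_le_pow_left₀ (by norm_num) ?_ L)
    have := Real.add_one_le_exp (1 : ℝ)
    linarith
  calc (1 - (q : ℝ) / (2 * n)) ^ (2 * (c + 2) * q * L)
      ≤ Real.exp (-(q / (2 * n))) ^ (2 * (c + 2) * q * L) := pow_le_pow_left₀ h0 h1 _
    _ ≤ Real.exp (-((c + 2) * L)) := h2
    _ = ((Real.exp 1 ^ L) ^ (c + 2))⁻¹ := h3
    _ ≤ ((n : ℝ) ^ (c + 2))⁻¹ := by gcongr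

/-- Union bound over all pairs `(x, v)`. These balls do not depend on the random words, unlike the
one around `z` that the algorithm needs. -/
theorem randomWords_not_hitsBalls_le (G : WDigraph n m) (B c : ℕ) (hn : 2 ≤ n)
    (hw : 2 * n ≤ 2 ^ w) :
    randomWords w {ω | ¬ HitsBalls G (by omega) B (rootCeil n)
      (2 * (c + 2) * rootCeil n * Nat.clog 2 n) ω} ≤ ((n : ℝ≥0∞) ^ c)⁻¹ := by
  classical
  have hn0 : 0 < n := by omega
  set k := 2 * (c + 2) * rootCeil n * Nat.clog 2 n with hk
  set A : Fin n × Fin n → Finset (Fin n) := fun p =>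
    Finset.univ.filter fun y => G.capDist B y p.2 ≤ G.capDist B p.1 p.2 with hA
  set P : Finset (Fin n × Fin n) := Finset.univ.filter fun p => rootCeil n ≤ (A p).card with hP
  have hsub : {ω : ℕ → Fin (2 ^ w) | ¬ HitsBalls G hn0 B (rootCeil n) k ω} ⊆
      ⋃ p ∈ P, {ω | ∀ i < k, ω i ∈ {x | sampleNode hn0 x ∉ A p}} := by
    intro ω hω
    simp only [Set.mem_ofPred_eq, HitsBalls] at hω
    push Not at hω
    obtain ⟨x, v, hq, hmiss⟩ := hω
    simp only [Set.mem_iUnion]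
    refine ⟨(x, v), ?_, fun i hi => ?_⟩
    · simp [hP, hA, hq]
    · simpa [hA] using hmiss i hi
  have hone : ∀ p ∈ P, randomWords w {ω | ∀ i < k, ω i ∈ {x | sampleNode hn0 x ∉ A p}} ≤
      ((n : ℝ≥0∞) ^ (c + 2))⁻¹ := by
    intro p hp
    rw [randomWords_forall_mem]
    have h1 := uniform_miss_le (q := rootCeil n) hn0 hw (A p) (by simpa [hP] using hp)
    refine (pow_le_pow_left' h1 k).trans ?_
    have hle : (0 : ℝ) ≤ 1 - (rootCeil n : ℝ) / (2 * n) := by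
      have h2 : (rootCeil n : ℝ) ≤ n := by exact_mod_cast rootCeil_le hn
      have h3 : (0 : ℝ) < n := by exact_mod_cast hn0
      rw [sub_nonneg, div_le_one (by positivity)]
      linarith
    rw [← ENNReal.ofReal_pow hle]
    refine (ENNReal.ofReal_le_ofReal (miss_pow_le hn0 (rootCeil_le hn)
      (le_rootCeil_mul_self n) (Nat.le_pow_clog (by omega) n))).trans ?_
    rw [ENNReal.ofReal_inv_of_pos (by positivity), ENNReal.ofReal_pow (by positivity),
      ENNReal.ofReal_natCast]
  refine (measure_mono hsub).trans ((measure_biUnion_finset_le P _).trans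
    ((Finset.sum_le_sum hone).trans ?_))
  -- Two of the `c + 2` powers of `n` pay for the at most `n ^ 2` pairs.
  have hcard : (P.card : ℝ≥0∞) ≤ (n : ℝ≥0∞) ^ 2 := by
    have h1 := Finset.card_le_univ P
    rw [Fintype.card_prod, Fintype.card_fin, ← pow_two] at h1
    exact_mod_cast h1
  have hne : (n : ℝ≥0∞) ^ 2 ≠ 0 := pow_ne_zero _ (by exact_mod_cast hn0.ne')
  have htop : (n : ℝ≥0∞) ^ 2 ≠ ⊤ := by finiteness
  rw [Finset.sum_const, nsmul_eq_mul]
  calc (P.card : ℝ≥0∞) * ((n : ℝ≥0∞) ^ (c + 2))⁻¹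
      ≤ (n : ℝ≥0∞) ^ 2 * ((n : ℝ≥0∞) ^ (c + 2))⁻¹ := by gcongr
    _ = ((n : ℝ≥0∞) ^ c)⁻¹ := by
      rw [pow_add, ENNReal.mul_inv (.inr htop) (.inr hne), mul_left_comm,
        ENNReal.mul_inv_cancel hne htop, mul_one]

/-! ## The running time in terms of real functions -/

theorem rootCeil_le_sqrt (hn : 2 ≤ n) : (rootCeil n : ℝ) ≤ 2 * √(n : ℝ) := by
  have h1 : ((n - 1).sqrt : ℝ) ≤ √(n : ℝ) :=
    Real.nat_sqrt_le_real_sqrt.trans (Real.sqrt_le_sqrt (by exact_mod_cast Nat.sub_le n 1))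
  have h2 : 1 ≤ √(n : ℝ) := Real.one_le_sqrt.2 (by exact_mod_cast (by omega : 1 ≤ n))
  rw [rootCeil]
  push_cast
  linarith

/-- With `L` the rounded-up logarithm, `2 ^ (L - 1) < n` gives `L * log 2 ≤ 2 * log n`, and `log 2 >
2 / 3`. -/
theorem clog_le_log (hn : 2 ≤ n) : (Nat.clog 2 n : ℝ) ≤ 3 * Real.log n := by
  have h1 := Nat.pow_pred_clog_lt_self (b := 2) (by omega) (by omega : 1 < n)
  have hL : 1 ≤ Nat.clog 2 n := Nat.clog_pos (by omega) hn
  have h2 : (2 : ℝ) ^ (Nat.clog 2 n).pred ≤ n := by exact_mod_cast h1.le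
  have h3 := Real.log_le_log (by positivity) h2
  rw [Real.log_pow, Nat.pred_eq_sub_one, Nat.cast_sub hL] at h3
  have h4 : Real.log 2 ≤ Real.log n := Real.log_le_log (by norm_num) (by exact_mod_cast hn)
  have h5 := Real.log_two_gt_d9
  push_cast at h3
  have h6 : (Nat.clog 2 n : ℝ) * Real.log 2 ≤ 2 * Real.log n := by linarith
  have h7 : (Nat.clog 2 n : ℝ) * (2 / 3) ≤ Nat.clog 2 n * Real.log 2 :=
    mul_le_mul_of_nonneg_left (by linarith) (by positivity)
  linarith

/-- The constant is `126000 = 7000 * 2 * 3 * 3`, from one factor `rootCeil n` and two factors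
`Nat.clog 2 n`. -/
theorem time_le_real {t K : ℕ} (hn : 2 ≤ n)
    (ht : t ≤ 7000 * (K + 1) * (m * rootCeil n * Nat.clog 2 n * Nat.clog 2 n)) :
    (t : ℝ) ≤ (126000 * (K + 1)) * (m * √(n : ℝ) * Real.log n ^ 2) := by
  have h1 := rootCeil_le_sqrt hn
  have h2 := clog_le_log hn
  have h0 : (0 : ℝ) ≤ Nat.clog 2 n := by positivity
  calc (t : ℝ) ≤ 7000 * (K + 1) * (m * rootCeil n * Nat.clog 2 n * Nat.clog 2 n) := by
        exact_mod_cast ht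
    _ ≤ 7000 * (K + 1) * (m * (2 * √(n : ℝ)) * (3 * Real.log n) * (3 * Real.log n)) := by
        have : 0 ≤ 3 * Real.log n := h0.trans h2
        gcongr
    _ = _ := by ring

end WordRAM

/-! ### The main theorem -/

theorem mainTheorem2 (c : ℕ) :
    ∃ (P : WordRAM.Cmd) (κ : ℕ) (C : ℝ), 1 ≤ κ ∧
      ∀ (n m M w : ℕ) (G : WDigraph n m), 2 ≤ n → 1 ≤ m → (∀ e, G.wt e ≤ M) →
        (n + m + M) ^ κ ≤ 2 ^ w →
        (∀ ω : ℕ → Fin (2 ^ w), ∃ (t : ℕ) (s : WordRAM.State),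
          WordRAM.Exec w ω P (WordRAM.input G) t s ∧
            (t : ℝ) ≤ C * (m * √(n : ℝ) * Real.log n ^ 2)) ∧
        WordRAM.randomWords w {ω | ¬ ∃ (t : ℕ) (s : WordRAM.State),
          WordRAM.Exec w ω P (WordRAM.input G) t s ∧
            G.sourceRadius ≤ s.output ∧ s.output ≤ 2 * G.sourceRadius} ≤
          ((n : ℝ≥0∞) ^ c)⁻¹ := by
  -- The `2` offsets the loss in `q / (2 * n)`, and `c + 2` leaves room for the union bound.
  set K := 2 * (c + 2) with hK
  -- Of the exponent `K + 5`, three powers bound the numbers that occur and `K + 2` powers absorb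
  -- the factor `K + 1`.
  refine ⟨WordRAM.radius K, K + 5, 126000 * (K + 1), by omega, ?_⟩
  intro n m M w G hn hm hM hκ
  have hw : (K + 1) * (n + m + M) ^ 3 < 2 ^ w := by
    have h1 : K + 1 < (n + m + M) ^ (K + 2) := by
      calc K + 1 < 2 ^ (K + 1) := Nat.lt_two_pow_self
        _ ≤ 2 ^ (K + 2) := Nat.pow_le_pow_right (by omega) (by omega)
        _ ≤ (n + m + M) ^ (K + 2) := Nat.pow_le_pow_left (by omega) _
    calc (K + 1) * (n + m + M) ^ 3 < (n + m + M) ^ (K + 2) * (n + m + M) ^ 3 :=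
          Nat.mul_lt_mul_of_pos_right h1 (Nat.pow_pos (by omega))
      _ = (n + m + M) ^ (K + 5) := by rw [← pow_add]
      _ ≤ 2 ^ w := hκ
  have hrun := fun ω => WordRAM.run_radius (ω := ω) hn hm hM hw
  constructor
  · intro ω
    obtain ⟨t, s, hx, ht, -⟩ := hrun ω
    exact ⟨t, s, hx, WordRAM.time_le_real hn ht⟩
  · have hfit := (WordRAM.fits_of_lt hn hm hM hw).nodes
    -- Failure implies that some ball is missed. Monotonicity of the measure is enough, so the
    -- failure event need not be shown measurable.
    refine le_trans (MeasureTheory.measure_mono ?_)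
      (WordRAM.randomWords_not_hitsBalls_le G (WordRAM.cap G) c hn (by omega))
    intro ω hω hH
    obtain ⟨t, s, hx, -, h⟩ := hrun ω
    exact hω ⟨t, s, hx, h hH⟩
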